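/- Let $\mathbf{k}$ be an algebraically closed field of characteristic zero. For a finite poset $\mathcal{P}$, let $\mathfrak{g}_A(\mathcal{P})$ be the type-A Lie poset algebra: the Lie algebra, under the commutator bracket, of all trace-zero matrices $(a_{i,j})_{i,j\in\mathcal{P}}$ over $\mathbf{k}$ with $a_{i,j}=0$ unless $i\preceq j$. A Lie algebra $\mathfrak{g}$ over $\mathbf{k}$ is called contact if $\dim\mathfrak{g}=2n+1$ for some $n\ge 0$ and there is a linear form $\varphi\in\mathfrak{g}^*$ with $\varphi\wedge(d\varphi)^n\neq 0$, where $d\varphi(x,y)=-\varphi([x,y])$. Let $Ext(\mathcal{P})$ be the set of elements of $\mathcal{P}$ that are minimal or maximal. For $i\in\mathcal{P}$, let $\mathcal{P}^i$ be the subposet of $\mathcal{P}$ induced on $\{j\in\mathcal{P} : i\preceq j\text{ or }j\preceq i\}$. The height of $\mathcal{P}$ is one less than the largest cardinality of a chain in $\mathcal{P}$, and $\mathcal{P}$ is connected if its Hasse diagram is connected as an undirected graph. **Theorem.** Let $\mathcal{P}$ be a connected finite poset of height two. Then $\mathfrak{g}_A(\mathcal{P})$ is contact if and only if the following three conditions hold: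 1. $|Ext(\mathcal{P}^i)|=2$ or $3$ for all $i\in\mathcal{P}\setminus Ext(\mathcal{P})$; 2. there exists a unique $i\in\mathcal{P}\setminus Ext(\mathcal{P})$ with $|Ext(\mathcal{P}^i)|=2$; 3. the Hasse diagram of the subposet of $\mathcal{P}$ induced on $Ext(\mathcal{P})$ is a tree. -/

import Mathlib

attribute [local instance 100] LieRing.ofAssociativeRing

namespace LiePoset

section Forms

variable {k : Type*} [Field k]

/-- The wedge product of a `p`-form and a `q`-form on a vector space `V`, as the sum over
`(p, q)`-shuffles. -/
noncomputable def wedge {V : Type*} [AddCommGroup V] [Module k V] {p q : ℕ}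
    (a : V [⋀^Fin p]→ₗ[k] k) (b : V [⋀^Fin q]→ₗ[k] k) : V [⋀^Fin (p + q)]→ₗ[k] k :=
  ((LinearMap.mul' k k).compAlternatingMap (a.domCoprod b)).domDomCongr finSumFinEquiv

/-- The `n`-fold wedge power of a two-form; the zeroth power is the constant `1`. -/
noncomputable def wedgePow {V : Type*} [AddCommGroup V] [Module k V]
    (ω : V [⋀^Fin 2]→ₗ[k] k) : (n : ℕ) → V [⋀^Fin (2 * n)]→ₗ[k] k
  | 0 => AlternatingMap.constOfIsEmpty k V (Fin 0) 1
  | n + 1 => wedge (wedgePow ω n) ω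

/-- A linear one-form, regarded as an alternating map in one variable. -/
noncomputable def oneForm {V : Type*} [AddCommGroup V] [Module k V]
    (φ : Module.Dual k V) : V [⋀^Fin 1]→ₗ[k] k :=
  AlternatingMap.ofSubsingleton k V k (0 : Fin 1) φ

/-- The (Chevalley-Eilenberg) differential of a one-form on a Lie algebra:
`dφ(x, y) = -φ([x, y])`. -/
noncomputable def extDeriv {g : Type*} [LieRing g] [LieAlgebra k g]
    (φ : Module.Dual k g) : g [⋀^Fin 2]→ₗ[k] k where
  toFun v := -φ ⁅v 0, v 1⁆
  map_update_add' v i x y := by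
    fin_cases i <;> simp <;> ring
  map_update_smul' v i c x := by
    fin_cases i <;> simp
  map_eq_zero_of_eq' v i j h hij := by
    have h01 : v 0 = v 1 := by
      fin_cases i <;> fin_cases j <;> simp_all
    simp [h01]

end Forms

/-- A Lie algebra `g` over `k` is contact if it has odd dimension `2 * n + 1` and there is a
one-form `φ` on `g` with `φ ∧ (dφ)^n ≠ 0`. -/
def IsContact (k g : Type*) [Field k] [LieRing g] [LieAlgebra k g] : Prop :=
  ∃ n : ℕ, Module.finrank k g = 2 * n + 1 ∧
    ∃ φ : Module.Dual k g, wedge (oneForm φ) (wedgePow (extDeriv φ) n) ≠ 0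

/-- The Lie poset algebra `g(P)`: the `P × P` matrices whose `(i, j)` entry vanishes unless
`i ≤ j`, with the commutator bracket. -/
def liePosetAlgebra (k P : Type*) [Field k] [Fintype P] [DecidableEq P] [PartialOrder P] :
    LieSubalgebra k (Matrix P P k) where
  carrier := {A | ∀ i j, ¬ i ≤ j → A i j = 0}
  zero_mem' := by intro i j _; rfl
  add_mem' := by
    intro A B hA hB i j h
    simp [hA i j h, hB i j h]
  smul_mem' := by
    intro c A hA i j h
    simp [hA i j h]
  lie_mem' := by
    have key : ∀ A B : Matrix P P k, (∀ i j, ¬ i ≤ j → A i j = 0) →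
        (∀ i j, ¬ i ≤ j → B i j = 0) → ∀ i j, ¬ i ≤ j → (A * B) i j = 0 := by
      intro A B hA hB i j h
      rw [Matrix.mul_apply]
      refine Finset.sum_eq_zero fun l _ => ?_
      by_cases h1 : i ≤ l
      · rw [hB l j fun h2 => h (h1.trans h2), mul_zero]
      · rw [hA i l h1, zero_mul]
    intro A B hA hB i j h
    rw [Ring.lie_def, Matrix.sub_apply, key A B hA hB i j h, key B A hB hA i j h, sub_zero]

/-- The type-A Lie poset algebra `g_A(P)`: the trace-zero matrices in `g(P)`. -/
def typeALiePosetAlgebra (k P : Type*) [Field k] [Fintype P] [DecidableEq P] [PartialOrder P] :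
    LieSubalgebra k (Matrix P P k) :=
  liePosetAlgebra k P ⊓ LieAlgebra.SpecialLinear.sl P k

/-- `Ext(P)`: the set of minimal and maximal elements of `P`. -/
def Ext (P : Type*) [PartialOrder P] : Set P := {x | IsMin x ∨ IsMax x}

/-- The set of elements of `P` comparable to `i`; the subposet `P^i` is the induced order
on it. -/
def comparable {P : Type*} [PartialOrder P] (i : P) : Set P := {j | i ≤ j ∨ j ≤ i}

end LiePoset

/-! A form `φ` is contact exactly when the radical of `dφ` is a line on which `φ` does not vanish. A
common kernel vector of `φ` and `dφ` kills the top form `φ ∧ (dφ)^n`. Conversely, if there is none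
and the radical contains `x` with `φ x ≠ 0`, then `dφ` is symplectic on `ker φ`, and a hyperbolic
basis shows the top form is nonzero. Writing `φ` as `X ↦ tr (F X)`, the radical consists of those
`X` for which `F X - X F` vanishes at `(b, a)` whenever `a ≤ b`.

Necessity. Matrices supported on strict extremal relations meet only the diagonal equations at
extremal elements, and these sum to zero. Contactness makes the system injective, so there are at
most `|Ext P| - 1` such relations; connectedness gives the reverse bound. Hence the graph is a tree,
and any solution of the other equations can be completed to a full one
(`ContactMatrix.exists_completion`). It remains to work near one non-extremal `m`. With at least
three elements on one side of `m` and one on the other, a local solution contradicts contactness;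
two on both sides give a 4-cycle. Each `m` with one element on either side yields a radical vector,
so there is at most one such `m`. Without any, the dimension would be even.

Sufficiency. Let `F` have weight one on the extremal relations, on one relation of each `m ≠ m₀`,
and at `(m₀, m₀)`. The equations then leave the diagonal free only at `m₀`, up to a common scalar,
and otherwise leave a circulation on a tree, which is zero. -/

namespace LiePoset

/-! ### Vanishing and nonvanishing of top-degree wedge products -/

section LinearAlgebra

variable {k V : Type*} [Field k] [AddCommGroup V] [Module k V]

open Equiv

/-- Every shuffle hands `x` to one of the two factors, and that factor vanishes. -/
theorem wedge_eq_zero_of_mem {p q : ℕ} (a : V [⋀^Fin p]→ₗ[k] k) (b : V [⋀^Fin q]→ₗ[k] k) (x : V)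
    (ha : ∀ v i, v i = x → a v = 0) (hb : ∀ v i, v i = x → b v = 0)
    (v : Fin (p + q) → V) (i : Fin (p + q)) (hi : v i = x) : wedge a b v = 0 := by
  have key : ∀ σ : Perm.ModSumCongr (Fin p) (Fin q),
      AlternatingMap.domCoprod.summand a b σ (v ∘ finSumFinEquiv) = 0 := by
    intro σ
    induction σ using Quotient.inductionOn' with | _ σ
    rw [AlternatingMap.domCoprod.summand_mk'']
    rcases h : σ.symm (finSumFinEquiv.symm i) with j | j
    · have h0 : (a fun l => v (finSumFinEquiv (σ (Sum.inl l)))) = 0 :=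
        ha _ j (by rw [← h]; simpa using hi)
      simp [MultilinearMap.domCoprod_apply, h0]
    · have h0 : (b fun l => v (finSumFinEquiv (σ (Sum.inr l)))) = 0 :=
        hb _ j (by rw [← h]; simpa using hi)
      simp [MultilinearMap.domCoprod_apply, h0]
  have : a.domCoprod b (v ∘ finSumFinEquiv) = 0 := by
    rw [AlternatingMap.domCoprod_apply, sum_apply]
    exact Finset.sum_eq_zero fun σ _ => key σ
  simp only [wedge, AlternatingMap.domDomCongr_apply, LinearMap.compAlternatingMap_apply]
  erw [this]
  simp

theorem wedgePow_eq_zero_of_mem (ω : V [⋀^Fin 2]→ₗ[k] k) (x : V) (hω : ∀ v i, v i = x → ω v = 0)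
    (n : ℕ) : ∀ v i, v i = x → wedgePow ω n v = 0 := by
  induction n with
  | zero => intro v i; exact i.elim0
  | succ n ih => exact wedge_eq_zero_of_mem _ _ x ih hω

/-- A nonzero vector killed by all the factors kills a wedge product of top degree. -/
theorem wedge_oneForm_wedgePow_eq_zero [FiniteDimensional k V] {n : ℕ}
    (hn : Module.finrank k V = 2 * n + 1) (φ : Module.Dual k V) (ω : V [⋀^Fin 2]→ₗ[k] k) (x : V)
    (hx : x ≠ 0) (hφ : φ x = 0) (hω : ∀ v i, v i = x → ω v = 0) :
    wedge (oneForm φ) (wedgePow ω n) = 0 := by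
  have hli : LinearIndepOn k id ({x} : Set V) := LinearIndepOn.singleton hx
  let b := Module.Basis.extend hli
  have hcard : Fintype.card (hli.extend (Set.subset_univ _)) = 1 + 2 * n := by
    rw [← Module.finrank_eq_card_basis b, hn, add_comm]
  let e := Fintype.equivFinOfCardEq hcard
  let b' := b.reindex e
  refine Module.Basis.ext_alternating b' fun v hv => ?_
  let x' : hli.extend (Set.subset_univ _) := ⟨x, hli.subset_extend _ rfl⟩
  -- In top degree an injective family of basis vectors uses all of them, so `x` occurs.
  obtain ⟨i, hi⟩ := (Finite.injective_iff_surjective.mp hv) (e x')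
  rw [AlternatingMap.zero_apply]
  refine wedge_eq_zero_of_mem _ _ x ?_ (wedgePow_eq_zero_of_mem ω x hω n) _ i ?_
  · intro v i hv
    rw [Subsingleton.elim i 0] at hv
    simp [oneForm, hv, hφ]
  · simp [hi, b', b, x']

/-- The wedge product before alternatization. -/
noncomputable def preWedge {p q : ℕ} (a : MultilinearMap k (fun _ : Fin p => V) k)
    (b : MultilinearMap k (fun _ : Fin q => V) k) : MultilinearMap k (fun _ : Fin (p + q) => V) k :=
  ((LinearMap.mul' k k).compMultilinearMap (a.domCoprod b)).domDomCongr finSumFinEquiv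

theorem preWedge_apply {p q : ℕ} (a : MultilinearMap k (fun _ : Fin p => V) k)
    (b : MultilinearMap k (fun _ : Fin q => V) k) (v : Fin (p + q) → V) :
    preWedge a b v = a (fun i => v (Fin.castAdd q i)) * b (fun i => v (Fin.natAdd p i)) := by
  simp [preWedge, MultilinearMap.domCoprod_apply]

theorem alternatization_preWedge {p q : ℕ} (a : MultilinearMap k (fun _ : Fin p => V) k)
    (b : MultilinearMap k (fun _ : Fin q => V) k) :
    (preWedge a b).alternatization = wedge a.alternatization b.alternatization := by
  rw [wedge, ← MultilinearMap.domCoprod_alternization]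
  ext v
  simp only [MultilinearMap.alternatization_apply, preWedge, AlternatingMap.domDomCongr_apply,
    LinearMap.compAlternatingMap_apply, MultilinearMap.domDomCongr_apply,
    LinearMap.compMultilinearMap_apply, map_sum]
  refine Fintype.sum_equiv (Equiv.permCongr finSumFinEquiv.symm) _ _ fun σ => ?_
  rw [Equiv.Perm.sign_permCongr]
  rcases Int.units_eq_one_or (Perm.sign σ) with h | h <;>
    simp [h]

theorem wedge_smul_smul {p q : ℕ} (a : V [⋀^Fin p]→ₗ[k] k) (b : V [⋀^Fin q]→ₗ[k] k) (c d : k) :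
    wedge (c • a) (d • b) = (c * d) • wedge a b := by
  have : (c • a).domCoprod (d • b) = (c * d) • a.domCoprod b := by
    rw [← AlternatingMap.domCoprod'_apply, TensorProduct.smul_tmul_smul, map_smul,
      AlternatingMap.domCoprod'_apply]
  ext v
  simp [wedge, this]

/-- The product of the values of a two-form on consecutive pairs of vectors. -/
noncomputable def preWedgePow (ω : V [⋀^Fin 2]→ₗ[k] k) :
    (n : ℕ) → MultilinearMap k (fun _ : Fin (2 * n) => V) k
  | 0 => MultilinearMap.constOfIsEmpty k (fun _ : Fin 0 => V) 1
  | n + 1 => preWedge (preWedgePow ω n) (ω : MultilinearMap k (fun _ : Fin 2 => V) k)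

/-- Alternatizing a form that is already alternating in two variables multiplies it by `2!`, once
for each factor. -/
theorem alternatization_preWedgePow (ω : V [⋀^Fin 2]→ₗ[k] k) (n : ℕ) :
    (preWedgePow ω n).alternatization = (2 : k) ^ n • wedgePow ω n := by
  induction n with
  | zero =>
    ext v
    simp [preWedgePow, wedgePow, MultilinearMap.alternatization_apply]
  | succ n ih =>
    rw [preWedgePow, alternatization_preWedge, ih, AlternatingMap.coe_alternatization, wedgePow,
      pow_succ, ← wedge_smul_smul]
    congr 1
    ext v
    simp

theorem preWedgePow_apply (ω : V [⋀^Fin 2]→ₗ[k] k) (n : ℕ) (v : Fin (2 * n) → V) :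
    preWedgePow ω n v =
      ∏ i : Fin n, ω ![v ⟨2 * i, by omega⟩, v ⟨2 * i + 1, by omega⟩] := by
  induction n with
  | zero => simp [preWedgePow]
  | succ n ih =>
    rw [preWedgePow, preWedge_apply, ih, Fin.prod_univ_castSucc]
    congr 1
    simp only [AlternatingMap.coe_multilinearMap]
    congr 1
    ext i
    fin_cases i <;> rfl

/-- The index set of a hyperbolic basis together with an extra vector. -/
def pairIndex (n : ℕ) : Option (Fin n × Fin 2) ≃ Fin (1 + 2 * n) :=
  ((Equiv.optionEquivSumPUnit.{0} _).trans (Equiv.sumComm _ _)).trans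
    ((Equiv.sumCongr (Equiv.ofUnique PUnit.{1} (Fin 1))
      (finProdFinEquiv.trans (finCongr (Nat.mul_comm n 2)))).trans finSumFinEquiv)

theorem pairIndex_none (n : ℕ) : pairIndex n none = Fin.castAdd (2 * n) 0 := by
  simp [pairIndex]

theorem pairIndex_some (n : ℕ) (i : Fin n) (a : Fin 2) :
    pairIndex n (some (i, a)) = Fin.natAdd 1 ⟨2 * i + a, by omega⟩ := by
  ext
  simp [pairIndex]
  ring

theorem two_pow_smul_wedge_apply (φ : Module.Dual k V) (ω : V [⋀^Fin 2]→ₗ[k] k) (n : ℕ)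
    (e : Option (Fin n × Fin 2) → V) :
    (2 : k) ^ n * wedge (oneForm φ) (wedgePow ω n) (e ∘ (pairIndex n).symm) =
      ∑ σ : Perm (Option (Fin n × Fin 2)), ((Perm.sign σ : ℤ) : k) *
        (φ (e (σ none)) * ∏ i, ω ![e (σ (some (i, 0))), e (σ (some (i, 1)))]) := by
  have h1 : (2 : k) ^ n • wedge (oneForm φ) (wedgePow ω n) =
      (preWedge (oneForm φ : MultilinearMap k (fun _ : Fin 1 => V) k)
        (preWedgePow ω n)).alternatization := by
    rw [alternatization_preWedge, alternatization_preWedgePow, AlternatingMap.coe_alternatization]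
    conv_lhs => rw [← one_mul ((2 : k) ^ n), ← wedge_smul_smul]
    simp
  rw [← smul_eq_mul, ← AlternatingMap.smul_apply, h1, MultilinearMap.alternatization_apply]
  refine Fintype.sum_equiv (Equiv.permCongr (pairIndex n).symm) _ _ fun σ => ?_
  rw [Equiv.Perm.sign_permCongr, MultilinearMap.domDomCongr_apply, preWedge_apply,
    preWedgePow_apply]
  have hs : ∀ z : k, Perm.sign σ • z = ((Perm.sign σ : ℤ) : k) * z := fun z => by
    rcases Int.units_eq_one_or (Perm.sign σ) with h | h <;> simp [h]
  rw [hs]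
  have h0 : ∀ v, (oneForm φ : MultilinearMap k (fun _ : Fin 1 => V) k) v = φ (v 0) := by
    intro v; simp [oneForm]
  rw [h0]
  simp only [Equiv.permCongr_apply, Equiv.symm_symm, pairIndex_none, pairIndex_some,
    Function.comp_apply, Fin.val_zero, Fin.val_one, add_zero]

theorem perm_fin_two_sign (π : Perm (Fin 2)) :
    (((π 1 : ℕ) : k) - ((π 0 : ℕ) : k)) = ((Perm.sign π : ℤ) : k) := by
  have : ((π 1 : ℕ) : ℤ) - ((π 0 : ℕ) : ℤ) = (Perm.sign π : ℤ) := by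
    revert π; decide
  rw [← this]; push_cast; rfl

/-- A nonzero product forces `ρ` to permute the pairs and to act inside each one. Permuting whole
pairs is even, so the sign of `ρ` is the product of the inner signs. The factors `J` produce that
same product, and the two signs cancel. -/
theorem hyperbolic_term (n : ℕ) (ρ : Perm (Fin n × Fin 2))
    (J : Fin n × Fin 2 → Fin n × Fin 2 → k)
    (hJ : ∀ x y, J x y = if x.1 = y.1 then ((y.2 : ℕ) : k) - ((x.2 : ℕ) : k) else 0) :
    ((Perm.sign ρ : ℤ) : k) * ∏ i, J (ρ (i, 0)) (ρ (i, 1)) = 0 ∨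
      ((Perm.sign ρ : ℤ) : k) * ∏ i, J (ρ (i, 0)) (ρ (i, 1)) = 1 := by
  by_cases h : ∀ i, (ρ (i, 0)).1 = (ρ (i, 1)).1
  · right
    have hfst : ∀ i a, (ρ (i, a)).1 = (ρ (i, 0)).1 := by
      intro i a; fin_cases a
      · rfl
      · exact (h i).symm
    let τf : Fin n → Fin n := fun i => (ρ (i, 0)).1
    have hτ : Function.Surjective τf := by
      intro j
      refine ⟨(ρ.symm (j, 0)).1, ?_⟩
      have := hfst (ρ.symm (j, 0)).1 (ρ.symm (j, 0)).2
      simp only [Prod.mk.eta, apply_symm_apply] at this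
      exact this.symm
    let τ : Perm (Fin n) := Equiv.ofBijective τf (Finite.surjective_iff_bijective.mp hτ)
    have hπ : ∀ i, Function.Injective fun a => (ρ (i, a)).2 := by
      intro i a b hab
      have : ρ (i, a) = ρ (i, b) := Prod.ext ((hfst i a).trans (hfst i b).symm) hab
      simpa using ρ.injective this
    let π : Fin n → Perm (Fin 2) := fun i =>
      Equiv.ofBijective _ (Finite.injective_iff_bijective.mp (hπ i))
    have hρ : ρ = Equiv.prodCongrLeft (fun _ : Fin 2 => τ) * Equiv.prodCongrRight π := by
      ext1 ⟨i, a⟩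
      refine Prod.ext ?_ rfl
      exact hfst i a
    have hsign : Perm.sign ρ = ∏ i, Perm.sign (π i) := by
      rw [hρ, Perm.sign_mul, Perm.sign_prodCongrLeft, Perm.sign_prodCongrRight]
      simp
    have hprod : ∏ i, J (ρ (i, 0)) (ρ (i, 1)) = ((Perm.sign ρ : ℤ) : k) := by
      rw [hsign]
      push_cast
      refine Finset.prod_congr rfl fun i _ => ?_
      rw [hJ, if_pos (h i), ← perm_fin_two_sign]
      rfl
    rw [hprod]
    rcases Int.units_eq_one_or (Perm.sign ρ) with h | h <;> simp [h]
  · left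
    push Not at h
    obtain ⟨i, hi⟩ := h
    rw [Finset.prod_eq_zero (Finset.mem_univ i), mul_zero]
    rw [hJ, if_neg hi]

/-- Evaluated on `x` and the `e i`, the permutation expansion is a natural number times `φ x`:
permutations moving `none` contribute zero, the others zero or `φ x`. The identity contributes `φ
x`, so in characteristic zero nothing cancels. -/
theorem wedge_ne_zero_of_hyperbolic [CharZero k] (φ : Module.Dual k V) (ω : V [⋀^Fin 2]→ₗ[k] k)
    (n : ℕ) (x : V) (hx : φ x ≠ 0) (e : Fin n × Fin 2 → V) (he : ∀ i, φ (e i) = 0)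
    (hω : ∀ i j, ω ![e i, e j] = if i.1 = j.1 then ((j.2 : ℕ) : k) - ((i.2 : ℕ) : k) else 0) :
    wedge (oneForm φ) (wedgePow ω n) ≠ 0 := by
  intro h0
  let e' : Option (Fin n × Fin 2) → V := fun o => o.elim x e
  have hsum := two_pow_smul_wedge_apply φ ω n e'
  rw [h0, AlternatingMap.zero_apply, mul_zero] at hsum
  have hterm : ∀ σ : Perm (Option (Fin n × Fin 2)), ∃ m : ℕ, ((Perm.sign σ : ℤ) : k) *
        (φ (e' (σ none)) * ∏ i, ω ![e' (σ (some (i, 0))), e' (σ (some (i, 1)))]) = m * φ x := by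
    intro σ
    rcases hσ : σ none with _ | j
    · obtain ⟨ρ, rfl⟩ : ∃ ρ : Perm (Fin n × Fin 2), σ = Equiv.optionCongr ρ :=
        ⟨Equiv.removeNone σ, by
          rw [map_equiv_removeNone, hσ, swap_self]; rfl⟩
      have := hyperbolic_term n ρ (fun i j => ω ![e i, e j]) hω
      simp only [Equiv.optionCongr_sign, Equiv.optionCongr_apply, Option.map_some, e',
        Option.elim_some, Option.elim_none]
      rcases this with h | h
      · exact ⟨0, by rw [mul_left_comm, h]; simp⟩
      · exact ⟨1, by rw [mul_left_comm, h]; simp⟩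
    · exact ⟨0, by simp [e', he]⟩
  choose m hm using hterm
  simp only [hm, ← Finset.sum_mul] at hsum
  rcases mul_eq_zero.mp hsum.symm with h | h
  · rw [← Nat.cast_sum, Nat.cast_eq_zero, Finset.sum_eq_zero_iff] at h
    have h1 := hm 1
    rw [h 1 (Finset.mem_univ _)] at h1
    simp only [Perm.sign_one, Perm.coe_one, id, e', Option.elim_some, Option.elim_none, hω] at h1
    simp [hx] at h1
  · exact hx h

/-- Symplectic Gram–Schmidt: split off a hyperbolic plane and recurse on its orthogonal complement.
-/
theorem exists_hyperbolic_basis (n : ℕ) : ∀ (V : Type*) [AddCommGroup V] [Module k V]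
    [FiniteDimensional k V] (B : LinearMap.BilinForm k V), B.IsAlt →
    (∀ x, (∀ y, B x y = 0) → x = 0) → Module.finrank k V ≤ n →
    ∃ m, Module.finrank k V = 2 * m ∧ ∃ e : Fin m × Fin 2 → V,
      ∀ i j, B (e i) (e j) = if i.1 = j.1 then ((j.2 : ℕ) : k) - ((i.2 : ℕ) : k) else 0 := by
  induction n with
  | zero =>
    intro V _ _ _ B _ _ hV
    exact ⟨0, by omega, fun i => i.1.elim0, fun i => i.1.elim0⟩
  | succ n ih =>
    intro V _ _ _ B hB hnd hV
    by_cases hzero : Module.finrank k V = 0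
    · exact ⟨0, by omega, fun i => i.1.elim0, fun i => i.1.elim0⟩
    have : Nontrivial V := Module.nontrivial_of_finrank_pos (R := k) (by omega)
    obtain ⟨x, hx⟩ := exists_ne (0 : V)
    obtain ⟨y, hxy⟩ : ∃ y, B x y = 1 := by
      by_contra! h
      refine hx (hnd x fun y => ?_)
      by_contra h'
      exact h ((B x y)⁻¹ • y) (by simp [h'])
    have hyx : B y x = -1 := by rw [← hB.neg_eq, hxy]
    let f : V →ₗ[k] k × k := (B x).prod (B y)
    have hfs : Function.Surjective f := by
      rintro ⟨a, b⟩
      exact ⟨a • y - b • x, by simp [f, hxy, hyx, hB.self_eq_zero]⟩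
    have hrank := f.finrank_range_add_finrank_ker
    rw [LinearMap.range_eq_top.mpr hfs, finrank_top, Module.finrank_prod, Module.finrank_self]
      at hrank
    have hmem : ∀ w, w ∈ LinearMap.ker f ↔ B x w = 0 ∧ B y w = 0 := by
      intro w; simp [f]
    obtain ⟨m, hm, e, he⟩ := ih (LinearMap.ker f) (B.restrict _) (fun w => hB _) (by
      intro w hw
      refine Subtype.ext (hnd _ fun v => ?_)
      -- This is the projection of `v` to the complement of the plane spanned by `x` and `y`.
      have hv : v + B y v • x - B x v • y ∈ LinearMap.ker f := by
        rw [hmem]; simp [hxy, hyx, hB.self_eq_zero]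
      have h1 := hw ⟨_, hv⟩
      have h2 := (hmem _).mp w.2
      have h3 : B w x = 0 := by rw [← hB.neg_eq, h2.1, neg_zero]
      have h4 : B w y = 0 := by rw [← hB.neg_eq, h2.2, neg_zero]
      simpa [h3, h4] using h1) (by omega)
    refine ⟨m + 1, by omega,
      fun i => Fin.cases (if i.2 = 0 then x else y) (fun j => (e (j, i.2) : V)) i.1, ?_⟩
    have hex : ∀ i, B x (e i) = 0 ∧ B y (e i) = 0 := fun i => (hmem _).mp (e i).2
    have hex' : ∀ i, B (e i) x = 0 ∧ B (e i) y = 0 := fun i =>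
      ⟨by rw [← hB.neg_eq, (hex i).1, neg_zero], by rw [← hB.neg_eq, (hex i).2, neg_zero]⟩
    rintro ⟨i, a⟩ ⟨j, b⟩
    refine Fin.cases ?_ (fun i => ?_) i <;> refine Fin.cases ?_ (fun j => ?_) j
    · fin_cases a <;> fin_cases b <;> simp [hxy, hyx, hB.self_eq_zero]
    · fin_cases a <;> simp [hex, (Fin.succ_ne_zero j).symm]
    · fin_cases b <;> simp [hex', Fin.succ_ne_zero i]
    · have := he (i, a) (j, b)
      simpa using this

end LinearAlgebra

/-! ### Contact forms in terms of the radical of `dφ` -/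

section Contact

variable {k g : Type*} [Field k] [LieRing g] [LieAlgebra k g] [FiniteDimensional k g]

theorem IsContact.exists_form (h : IsContact k g) : Odd (Module.finrank k g) ∧
    ∃ φ : Module.Dual k g, ∀ x, (∀ y, φ ⁅x, y⁆ = 0) → φ x = 0 → x = 0 := by
  obtain ⟨n, hn, φ, hφ⟩ := h
  refine ⟨⟨n, hn⟩, φ, fun x hx h0 => ?_⟩
  by_contra hne
  refine hφ (wedge_oneForm_wedgePow_eq_zero hn φ _ x hne h0 ?_)
  intro v i hi
  change -φ ⁅v 0, v 1⁆ = 0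
  fin_cases i
  · simp only [Fin.zero_eta] at hi
    rw [hi, hx, neg_zero]
  · simp only [Fin.mk_one] at hi
    rw [← lie_skew, hi, map_neg, hx, neg_zero, neg_zero]

/-- Since `x` lies in the radical and off `ker φ`, a vector of `ker φ` orthogonal to `ker φ` is
orthogonal to everything. So `dφ` is symplectic on `ker φ`, and odd dimension is a consequence. -/
theorem isContact_of_form [CharZero k] (φ : Module.Dual k g)
    (hφ : ∀ x, (∀ y, φ ⁅x, y⁆ = 0) → φ x = 0 → x = 0)
    (x : g) (hx : ∀ y, φ ⁅x, y⁆ = 0) (hx0 : φ x ≠ 0) : IsContact k g := by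
  let B : LinearMap.BilinForm k g :=
    LinearMap.mk₂ k (fun a b => -φ ⁅a, b⁆) (by intros; simp; ring) (by intros; simp)
      (by intros; simp; ring) (by intros; simp)
  have hB : ∀ a b, B a b = -φ ⁅a, b⁆ := fun a b => rfl
  let W := LinearMap.ker φ
  obtain ⟨m, hm, e, he⟩ := exists_hyperbolic_basis (k := k) _ W (B.restrict W)
    (fun w => by simp [hB]) (by
      intro w hw
      refine Subtype.ext (hφ _ (fun v => ?_) w.2)
      have hv : v - (φ v / φ x) • x ∈ W := by simp [W, hx0]
      have h1 := hw ⟨_, hv⟩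
      have h2 : φ ⁅(w : g), x⁆ = 0 := by rw [← lie_skew, map_neg, hx, neg_zero]
      simpa [hB, h2] using h1) le_rfl
  have hrank := φ.finrank_range_add_finrank_ker
  have hs : Function.Surjective φ := fun c => ⟨(c / φ x) • x, by simp [hx0]⟩
  rw [LinearMap.range_eq_top.mpr hs, finrank_top, Module.finrank_self] at hrank
  have hm' : Module.finrank k (LinearMap.ker φ) = 2 * m := hm
  refine ⟨m, by omega, φ, wedge_ne_zero_of_hyperbolic φ _ m x hx0 (fun i => (e i : g))
    (fun i => (e i).2) ?_⟩
  intro i j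
  rw [← he i j]
  rfl

end Contact

/-! ### Linear forms as trace pairings, and the dimension -/

section MatrixCriterion

variable {k P : Type*} [Field k] [Fintype P] [DecidableEq P] [PartialOrder P]

open Matrix

theorem mem_typeALiePosetAlgebra {X : Matrix P P k} : X ∈ typeALiePosetAlgebra k P ↔
    (∀ i j, ¬ i ≤ j → X i j = 0) ∧ X.trace = 0 := by
  simp only [typeALiePosetAlgebra, LieSubalgebra.mem_inf]
  refine and_congr Iff.rfl ?_
  exact Iff.rfl

instance : FiniteDimensional k (typeALiePosetAlgebra k P) :=
  inferInstanceAs (FiniteDimensional k (typeALiePosetAlgebra k P).toSubmodule)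

theorem exists_matrix_of_dual (φ : Module.Dual k (typeALiePosetAlgebra k P)) :
    ∃ F : Matrix P P k, ∀ x : typeALiePosetAlgebra k P, φ x = (F * (x : Matrix P P k)).trace := by
  obtain ⟨ψ, hψ⟩ := LinearMap.exists_extend (p := (typeALiePosetAlgebra k P).toSubmodule) φ
  refine ⟨Matrix.of fun b a => ψ (single a b 1), fun x => ?_⟩
  have h1 : φ x = ψ (x : Matrix P P k) := by rw [← hψ]; rfl
  rw [h1]
  conv_lhs => rw [matrix_eq_sum_single (x : Matrix P P k)]
  simp only [map_sum, trace, diag_apply, mul_apply, of_apply]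
  rw [Finset.sum_comm]
  refine Finset.sum_congr rfl fun b _ => Finset.sum_congr rfl fun a _ => ?_
  have : single a b ((x : Matrix P P k) a b) = (x : Matrix P P k) a b • single a b (1 : k) := by
    simp
  rw [this, map_smul, smul_eq_mul, mul_comm]

/-- The linear form on the Lie poset algebra given by the trace pairing with `F`. -/
noncomputable def traceForm (F : Matrix P P k) : Module.Dual k (typeALiePosetAlgebra k P) :=
  (Matrix.traceLinearMap P k k ∘ₗ LinearMap.mulLeft k F) ∘ₗ
    (typeALiePosetAlgebra k P).toSubmodule.subtype

theorem traceForm_apply (F : Matrix P P k) (x : typeALiePosetAlgebra k P) :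
    traceForm F x = (F * (x : Matrix P P k)).trace := rfl

omit [PartialOrder P] in
theorem trace_mul_lie (F X Y : Matrix P P k) :
    (F * ⁅X, Y⁆).trace = ((F * X - X * F) * Y).trace := by
  rw [Ring.lie_def, mul_sub, sub_mul, trace_sub, trace_sub, ← mul_assoc, ← mul_assoc,
    Matrix.trace_mul_cycle F Y X]

theorem traceForm_lie_eq_zero_iff [CharZero k] (F : Matrix P P k)
    (x : typeALiePosetAlgebra k P) :
    (∀ y, traceForm F ⁅x, y⁆ = 0) ↔
      ∀ a b, a ≤ b → (F * (x : Matrix P P k) - (x : Matrix P P k) * F) b a = 0 := by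
  set G := F * (x : Matrix P P k) - (x : Matrix P P k) * F with hG
  have hval : ∀ y : typeALiePosetAlgebra k P,
      traceForm F ⁅x, y⁆ = (G * (y : Matrix P P k)).trace := by
    intro y
    rw [traceForm_apply, LieSubalgebra.coe_bracket, trace_mul_lie]
  have htr : G.trace = 0 := by rw [hG, trace_sub, trace_mul_comm, sub_self]
  constructor
  · intro h a b hab
    have hcard : (Fintype.card P : k) ≠ 0 := by
      have : Nonempty P := ⟨a⟩
      exact_mod_cast Fintype.card_ne_zero
    let Z : Matrix P P k := single a b 1
    -- The scalar correction makes the elementary matrix trace-zero; it is invisible to the pairing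
    -- because the commutator `G` has trace zero.
    let Y : Matrix P P k := Z - (Z.trace / Fintype.card P) • (1 : Matrix P P k)
    have hY : Y ∈ typeALiePosetAlgebra k P := by
      rw [mem_typeALiePosetAlgebra]
      constructor
      · intro i j hij
        have h1 : i ≠ j := fun h => hij h.le
        have h2 : ¬ (a = i ∧ b = j) := by rintro ⟨rfl, rfl⟩; exact hij hab
        simp [Y, Z, one_apply, h1, h2]
      · simp [Y, trace_sub, trace_smul, hcard]
    have h1 := (hval ⟨Y, hY⟩).symm.trans (h _)
    simp only [Y, mul_sub, trace_sub, mul_smul_comm, mul_one, trace_smul, htr, smul_zero,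
      sub_zero] at h1
    simpa [Z, trace_mul_single] using h1
  · intro h y
    rw [hval, trace]
    refine Finset.sum_eq_zero fun b _ => ?_
    rw [diag_apply, mul_apply]
    refine Finset.sum_eq_zero fun a _ => ?_
    by_cases hab : a ≤ b
    · rw [h a b hab, zero_mul]
    · rw [(mem_typeALiePosetAlgebra.mp y.2).1 a b hab, mul_zero]

/-- The only element of the Lie poset algebra in the kernels of both the form given by `F` and its
differential is zero. -/
def ContactMatrix (F : Matrix P P k) : Prop :=
  ∀ X : Matrix P P k, (∀ i j, ¬ i ≤ j → X i j = 0) → X.trace = 0 →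
    (∀ a b, a ≤ b → (F * X - X * F) b a = 0) → (F * X).trace = 0 → X = 0

theorem exists_contactMatrix [CharZero k] (h : IsContact k (typeALiePosetAlgebra k P)) :
    ∃ F : Matrix P P k, ContactMatrix F := by
  obtain ⟨-, φ, hφ⟩ := h.exists_form
  obtain ⟨F, hF⟩ := exists_matrix_of_dual φ
  obtain rfl : φ = traceForm F := LinearMap.ext hF
  refine ⟨F, fun X h1 h2 h3 h4 => ?_⟩
  have := hφ ⟨X, mem_typeALiePosetAlgebra.mpr ⟨h1, h2⟩⟩
    ((traceForm_lie_eq_zero_iff F _).mpr h3) h4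
  exact congrArg Subtype.val this

theorem ContactMatrix.isContact [CharZero k] {F : Matrix P P k} (hF : ContactMatrix F)
    (X : Matrix P P k) (h1 : ∀ i j, ¬ i ≤ j → X i j = 0) (h2 : X.trace = 0)
    (h3 : ∀ a b, a ≤ b → (F * X - X * F) b a = 0) (h4 : (F * X).trace ≠ 0) :
    IsContact k (typeALiePosetAlgebra k P) := by
  refine isContact_of_form (traceForm F) (fun x hx h0 => ?_)
    ⟨X, mem_typeALiePosetAlgebra.mpr ⟨h1, h2⟩⟩ ((traceForm_lie_eq_zero_iff F _).mpr h3) h4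
  have hx' := mem_typeALiePosetAlgebra.mp x.2
  exact Subtype.ext (hF x hx'.1 hx'.2 ((traceForm_lie_eq_zero_iff F _).mp hx) h0)

open Classical in
theorem finrank_typeALiePosetAlgebra [Nonempty P] :
    Module.finrank k (typeALiePosetAlgebra k P) + 1 =
      (Finset.univ.filter fun p : P × P => p.1 ≤ p.2).card := by
  let I := {p : P × P // p.1 ≤ p.2}
  let T : (I → k) →ₗ[k] k := ∑ a : P, LinearMap.proj (⟨(a, a), le_rfl⟩ : I)
  have hT : ∀ f, T f = ∑ a : P, f ⟨(a, a), le_rfl⟩ := fun f => by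
    simp [T, LinearMap.sum_apply]
  have hrank := T.finrank_range_add_finrank_ker
  have hs : Function.Surjective T := by
    obtain ⟨a⟩ := ‹Nonempty P›
    intro c
    refine ⟨fun p => if p.1.1 = a then c else 0, ?_⟩
    simp [hT]
  rw [LinearMap.range_eq_top.mpr hs, finrank_top, Module.finrank_self,
    Module.finrank_fintype_fun_eq_card, Fintype.card_subtype] at hrank
  let e : LinearMap.ker T ≃ₗ[k] typeALiePosetAlgebra k P :=
    { toFun := fun f => ⟨Matrix.of fun i j => if h : i ≤ j then f.1 ⟨(i, j), h⟩ else 0, by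
        rw [mem_typeALiePosetAlgebra]
        refine ⟨fun i j h => by simp [h], ?_⟩
        have := f.2
        rw [LinearMap.mem_ker, hT] at this
        simpa [trace] using this⟩
      map_add' := fun f g => by
        refine Subtype.ext ?_
        ext i j
        by_cases h : i ≤ j <;> simp [h]
      map_smul' := fun c f => by
        refine Subtype.ext ?_
        ext i j
        by_cases h : i ≤ j <;> simp [h]
      invFun := fun x => ⟨fun p => (x : Matrix P P k) p.1.1 p.1.2, by
        rw [LinearMap.mem_ker, hT]
        exact (mem_typeALiePosetAlgebra.mp x.2).2⟩
      left_inv := fun f => by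
        refine Subtype.ext (funext fun p => ?_)
        simp [p.2]
      right_inv := fun x => by
        refine Subtype.ext ?_
        ext i j
        by_cases h : i ≤ j
        · simp [h]
        · simp [h, (mem_typeALiePosetAlgebra.mp x.2).1 i j h] }
  rw [← e.finrank_eq, add_comm, hrank]

end MatrixCriterion

/-! ### Extremal elements of posets without four-element chains -/

section Poset

variable {P : Type*} [PartialOrder P]

/-- The poset has no chain of four elements. -/
def NoFourChain (P : Type*) [PartialOrder P] : Prop :=
  ∀ a b c d : P, a < b → b < c → c < d → False

theorem noFourChain_of_krullDim (h : Order.krullDim P = 2) : NoFourChain P := by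
  intro a b c d hab hbc hcd
  let s : LTSeries P :=
    { length := 3
      toFun := ![a, b, c, d]
      step := by intro i; fin_cases i <;> assumption }
  have h1 := Order.le_krullDim_iff.mpr ⟨s, rfl⟩
  rw [h] at h1
  have h2 : ((3 : ℕ) : WithBot ℕ∞) ≤ ((2 : ℕ) : WithBot ℕ∞) := h1
  norm_cast at h2

theorem exists_mem_ext [Finite P] [Nonempty P] : (Ext P).Nonempty := by
  obtain ⟨m, hm⟩ := Set.finite_univ.exists_minimal (Set.univ_nonempty (α := P))
  exact ⟨m, Or.inl fun b hb => hm.2 trivial hb⟩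

theorem isMin_of_mem_ext {a b : P} (ha : a ∈ Ext P) (hab : a < b) : IsMin a :=
  ha.resolve_right fun h => h.not_lt hab

theorem isMax_of_mem_ext {a b : P} (hb : b ∈ Ext P) (hab : a < b) : IsMax b :=
  hb.resolve_left fun h => h.not_lt hab

theorem exists_lt_of_notMem_ext {m : P} (hm : m ∉ Ext P) : ∃ a, a < m :=
  not_isMin_iff.mp fun h => hm (Or.inl h)

theorem exists_gt_of_notMem_ext {m : P} (hm : m ∉ Ext P) : ∃ b, m < b :=
  not_isMax_iff.mp fun h => hm (Or.inr h)

theorem NoFourChain.isMin_of_lt (h : NoFourChain P) {a m : P} (hm : m ∉ Ext P) (ham : a < m) :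
    IsMin a := by
  obtain ⟨b, hb⟩ := exists_gt_of_notMem_ext hm
  rw [isMin_iff_forall_not_lt]
  exact fun c hc => h c a m b hc ham hb

theorem NoFourChain.isMax_of_gt (h : NoFourChain P) {b m : P} (hm : m ∉ Ext P) (hmb : m < b) :
    IsMax b := by
  obtain ⟨a, ha⟩ := exists_lt_of_notMem_ext hm
  rw [isMax_iff_forall_not_lt]
  exact fun c hc => h a m b c ha hmb hc

theorem ncard_ext_comparable [Fintype P] (h : NoFourChain P) {m : P} (hm : m ∉ Ext P) :
    (Ext (comparable m)).ncard = {a | a < m}.ncard + {b | m < b}.ncard := by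
  rw [← Set.ncard_image_of_injective _ Subtype.val_injective, ← Set.ncard_union_eq]
  · congr 1
    ext j
    constructor
    · rintro ⟨⟨j, hj⟩, hext, rfl⟩
      have hne : j ≠ m := by
        rintro rfl
        obtain ⟨a, ha⟩ := exists_lt_of_notMem_ext hm
        obtain ⟨b, hb⟩ := exists_gt_of_notMem_ext hm
        rcases hext with h1 | h1
        · exact h1.not_lt (b := ⟨a, Or.inr ha.le⟩) ha
        · exact h1.not_lt (b := ⟨b, Or.inl hb.le⟩) hb
      rcases hj with hj | hj
      · exact Or.inr (lt_of_le_of_ne hj hne.symm)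
      · exact Or.inl (lt_of_le_of_ne hj hne)
    · rintro (hj | hj)
      · refine ⟨⟨j, Or.inr (le_of_lt hj)⟩, Or.inl fun b hb => h.isMin_of_lt hm hj hb, rfl⟩
      · refine ⟨⟨j, Or.inl (le_of_lt hj)⟩, Or.inr fun b hb => h.isMax_of_gt hm hj hb, rfl⟩
  · rw [Set.disjoint_left]
    exact fun x hx hx' => lt_asymm hx hx'

/-- No extremal element lies strictly between two others, so every strict relation is a cover. -/
theorem hasse_ext_adj {a b : Ext P} : (SimpleGraph.hasse (Ext P)).Adj a b ↔
    (a : P) < b ∨ (b : P) < a := by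
  have key : ∀ a b : Ext P, a ⋖ b ↔ (a : P) < b := fun a b => by
    refine ⟨fun h => h.lt, fun h => ⟨h, fun c hac hcb => ?_⟩⟩
    exact (isMin_of_mem_ext c.2 hcb).not_lt hac
  rw [SimpleGraph.hasse_adj, key, key]

/-- The map `r` fixes extremal elements and sends any other to a maximal element above it; it
carries edges to reachable pairs. -/
theorem hasse_ext_connected [Finite P] (h : NoFourChain P)
    (hconn : (SimpleGraph.hasse P).Connected) : (SimpleGraph.hasse (Ext P)).Connected := by
  classical
  have hex : ∀ v : P, ∃ w : Ext P, (v ∈ Ext P → v = w) ∧ (v ∉ Ext P → v < w) := by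
    intro v
    by_cases hv : v ∈ Ext P
    · exact ⟨⟨v, hv⟩, fun _ => rfl, fun h => absurd hv h⟩
    · obtain ⟨b, hb⟩ := exists_gt_of_notMem_ext hv
      exact ⟨⟨b, Or.inr (h.isMax_of_gt hv hb)⟩, fun h => absurd h hv, fun _ => hb⟩
  choose r hr1 hr2 using hex
  have hlt : ∀ v w, v < w → (SimpleGraph.hasse (Ext P)).Reachable (r v) (r w) := by
    intro v w hvw
    by_cases hv : v ∈ Ext P <;> by_cases hw : w ∈ Ext P
    · refine SimpleGraph.Adj.reachable (hasse_ext_adj.mpr (Or.inl ?_))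
      rwa [← hr1 v hv, ← hr1 w hw]
    · refine SimpleGraph.Adj.reachable (hasse_ext_adj.mpr (Or.inl ?_))
      rw [← hr1 v hv]
      exact hvw.trans (hr2 w hw)
    -- A minimal `a` below `v` lies below both `r v` and `r w = w`.
    · obtain ⟨a, ha⟩ := exists_lt_of_notMem_ext hv
      have ha' : a ∈ Ext P := Or.inl (h.isMin_of_lt hv ha)
      have h1 : (SimpleGraph.hasse (Ext P)).Adj ⟨a, ha'⟩ (r v) :=
        hasse_ext_adj.mpr (Or.inl (ha.trans (hr2 v hv)))
      have h2 : (SimpleGraph.hasse (Ext P)).Adj ⟨a, ha'⟩ (r w) :=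
        hasse_ext_adj.mpr (Or.inl (by rw [← hr1 w hw]; exact ha.trans hvw))
      exact h1.reachable.symm.trans h2.reachable
    · exact absurd (Or.inl (h.isMin_of_lt hw hvw)) hv
  have hwalk : ∀ v w, (SimpleGraph.hasse P).Reachable v w →
      (SimpleGraph.hasse (Ext P)).Reachable (r v) (r w) := by
    rintro v w ⟨p⟩
    induction p with
    | nil => rfl
    | cons hadj _ ih =>
      refine SimpleGraph.Reachable.trans ?_ ih
      rcases hadj with h1 | h1
      · exact hlt _ _ h1.lt
      · exact (hlt _ _ h1.lt).symm
  have := hconn.nonempty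
  rw [SimpleGraph.connected_iff]
  refine ⟨fun v w => ?_, (exists_mem_ext (P := P)).to_subtype⟩
  have h1 := hwalk v w (hconn.preconnected v w)
  rwa [← Subtype.ext (hr1 v v.2), ← Subtype.ext (hr1 w w.2)] at h1

/-- The strict relations between extremal elements. -/
abbrev ExtRel (P : Type*) [PartialOrder P] : Type _ :=
  {p : P × P // p.1 ∈ Ext P ∧ p.2 ∈ Ext P ∧ p.1 < p.2}

theorem card_edgeSet_hasse_ext :
    Nat.card (SimpleGraph.hasse (Ext P)).edgeSet = Nat.card (ExtRel P) := by
  refine (Nat.card_congr (Equiv.ofBijective (fun p : ExtRel P =>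
    (⟨s(⟨p.1.1, p.2.1⟩, ⟨p.1.2, p.2.2.1⟩), hasse_ext_adj.mpr (Or.inl p.2.2.2)⟩ :
      (SimpleGraph.hasse (Ext P)).edgeSet)) ⟨?_, ?_⟩)).symm
  · rintro ⟨⟨a, b⟩, ha, hb, hab⟩ ⟨⟨c, d⟩, hc, hd, hcd⟩ heq
    rcases Sym2.eq_iff.mp (congrArg Subtype.val heq) with ⟨h1, h2⟩ | ⟨h1, h2⟩
    · exact Subtype.ext (Prod.ext (congrArg Subtype.val h1) (congrArg Subtype.val h2))
    · obtain rfl : a = d := congrArg Subtype.val h1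
      obtain rfl : b = c := congrArg Subtype.val h2
      exact absurd hab (lt_asymm hcd)
  · rintro ⟨e, he⟩
    induction e using Sym2.ind with | _ a b
    rcases hasse_ext_adj.mp he with h | h
    · exact ⟨⟨(a, b), a.2, b.2, h⟩, rfl⟩
    · exact ⟨⟨(b, a), b.2, a.2, h⟩, Subtype.ext Sym2.eq_swap⟩

theorem not_isTree_of_lt_lt {a a' b b' : P} (ha : a ∈ Ext P) (ha' : a' ∈ Ext P) (hb : b ∈ Ext P)
    (hb' : b' ∈ Ext P) (h1 : a < b) (h2 : a' < b) (h3 : a < b') (h4 : a' < b') (haa' : a ≠ a')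
    (hbb' : b ≠ b') : ¬ (SimpleGraph.hasse (Ext P)).IsTree := by
  intro h
  let p : (SimpleGraph.hasse (Ext P)).Walk ⟨a, ha⟩ ⟨a', ha'⟩ :=
    .cons (v := ⟨b, hb⟩) (hasse_ext_adj.mpr (Or.inl h1))
      (.cons (hasse_ext_adj.mpr (Or.inr h2)) .nil)
  let q : (SimpleGraph.hasse (Ext P)).Walk ⟨a, ha⟩ ⟨a', ha'⟩ :=
    .cons (v := ⟨b', hb'⟩) (hasse_ext_adj.mpr (Or.inl h3))
      (.cons (hasse_ext_adj.mpr (Or.inr h4)) .nil)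
  have hp : p.IsPath := by simp [p, h1.ne, h2.ne', haa']
  have hq : q.IsPath := by simp [q, h3.ne, h4.ne', haa']
  have := congrArg (fun w : (SimpleGraph.hasse (Ext P)).Path _ _ => w.1.support)
    ((h.isAcyclic.subsingleton_path _ _).elim ⟨p, hp⟩ ⟨q, hq⟩)
  simp [p, q, hbb'] at this

open Classical in
-- A strict relation has at most one non-extremal end, since two would extend to a four-chain.
-- Relations with such an end are counted there.
theorem card_le_pairs [Fintype P] (h : NoFourChain P) :
    (Finset.univ.filter fun p : P × P => p.1 ≤ p.2).card =
      Fintype.card P + Nat.card (ExtRel P) +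
        ∑ m ∈ Finset.univ.filter (fun m : P => m ∉ Ext P), (Ext (comparable m)).ncard := by
  have hpt : ∀ p : P × P, (if p.1 ≤ p.2 then 1 else 0 : ℕ) =
      (if p.1 = p.2 then 1 else 0) + (if p.1 ∈ Ext P ∧ p.2 ∈ Ext P ∧ p.1 < p.2 then 1 else 0) +
      ((if p.2 ∉ Ext P then (if p.1 < p.2 then 1 else 0) else 0) +
        (if p.1 ∉ Ext P then (if p.1 < p.2 then 1 else 0) else 0)) := by
    rintro ⟨a, b⟩
    rcases eq_or_ne a b with rfl | hab
    · simp
    · by_cases hle : a ≤ b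
      · have hlt : a < b := lt_of_le_of_ne hle hab
        by_cases ha : a ∈ Ext P <;> by_cases hb : b ∈ Ext P <;> simp [ha, hb, hlt, hlt.le, hab]
        exact ha (Or.inl (h.isMin_of_lt hb hlt))
      · have hlt : ¬ a < b := fun h => hle h.le
        simp [hle, hlt, hab]
  rw [Finset.card_filter, Finset.sum_congr rfl fun p _ => hpt p, Finset.sum_add_distrib,
    Finset.sum_add_distrib, Finset.sum_add_distrib]
  congr 1
  · congr 1
    · rw [Fintype.sum_prod_type]
      simp only [Finset.sum_ite_eq, Finset.mem_univ, if_true, Finset.sum_const, Finset.card_univ,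
        smul_eq_mul, mul_one]
    · rw [Nat.card_eq_fintype_card, Fintype.card_subtype, Finset.card_filter]
  · rw [Fintype.sum_prod_type_right, Fintype.sum_prod_type, ← Finset.sum_add_distrib,
      Finset.sum_filter]
    refine Finset.sum_congr rfl fun m _ => ?_
    by_cases hm : m ∈ Ext P
    · simp [hm]
    · simp only [hm, not_false_eq_true, if_true]
      rw [ncard_ext_comparable h hm, Set.ncard_eq_toFinset_card', Set.ncard_eq_toFinset_card',
        ← Finset.card_filter, ← Finset.card_filter]
      simp

end Poset

/-! ### Necessity: the tree condition and the values two and three -/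

section Necessity

variable {k P : Type*} [Field k] [Fintype P] [DecidableEq P] [PartialOrder P]

open Matrix

omit [DecidableEq P] [PartialOrder P] in
theorem commutator_apply (F X : Matrix P P k) (a b : P) :
    (F * X - X * F) b a = ∑ i, F b i * X i a - ∑ j, X b j * F j a := by
  simp [Matrix.sub_apply, mul_apply]

omit [DecidableEq P] in
-- At a minimal `v` the column of `X` is diagonal; at a maximal `v` the row is, and the kernel
-- equation trades `F X` for `X F`.
theorem mul_apply_self_eq_zero (F X : Matrix P P k) (hX : ∀ i j, ¬ i ≤ j → X i j = 0) {v : P}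
    (hv : v ∈ Ext P) (hE : (F * X - X * F) v v = 0) (hdiag : F v v * X v v = 0) :
    (F * X) v v = 0 := by
  rcases hv with hmin | hmax
  · rw [mul_apply]
    refine Finset.sum_eq_zero fun i _ => ?_
    rcases eq_or_ne i v with rfl | h
    · exact hdiag
    · rw [hX _ _ fun h' => h (hmin.eq_of_le h'), mul_zero]
  · rw [sub_eq_zero.mp hE, mul_apply]
    refine Finset.sum_eq_zero fun j _ => ?_
    rcases eq_or_ne v j with rfl | h
    · rw [mul_comm, hdiag]
    · rw [hX _ _ fun h' => h (hmax.eq_of_le h'), zero_mul]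

omit [DecidableEq P] in
/-- The diagonal part of the kernel equations at extremal elements forces the trace pairing to only
see the diagonal entries and the columns of non-extremal elements. -/
theorem trace_mul_eq_zero (F X : Matrix P P k) (hX : ∀ i j, ¬ i ≤ j → X i j = 0)
    (hE : ∀ v ∈ Ext P, (F * X - X * F) v v = 0) (hdiag : ∀ v ∈ Ext P, X v v = 0)
    (hcol : ∀ v, v ∉ Ext P → (F * X) v v = 0) : (F * X).trace = 0 := by
  refine Finset.sum_eq_zero fun v _ => ?_
  by_cases hv : v ∈ Ext P
  · exact mul_apply_self_eq_zero F X hX hv (hE v hv) (by rw [hdiag v hv, mul_zero])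
  · exact hcol v hv

open Classical in
/-- A matrix supported on the strict relations between extremal elements. -/
noncomputable def extMatrix :
    (ExtRel P → k) →ₗ[k] Matrix P P k where
  toFun y := Matrix.of fun a b =>
    if h : a ∈ Ext P ∧ b ∈ Ext P ∧ a < b then y ⟨(a, b), h⟩ else 0
  map_add' y z := by
    ext a b
    by_cases h : a ∈ Ext P ∧ b ∈ Ext P ∧ a < b <;> simp [h]
  map_smul' c y := by
    ext a b
    by_cases h : a ∈ Ext P ∧ b ∈ Ext P ∧ a < b <;> simp [h]

omit [Fintype P] [DecidableEq P] in
theorem extMatrix_support (y : ExtRel P → k) (a b : P) (h : extMatrix y a b ≠ 0) :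
    a ∈ Ext P ∧ b ∈ Ext P ∧ a < b := by
  by_contra h'
  exact h (dif_neg h')

omit [DecidableEq P] in
-- `F Y` lives in columns of maximal elements and `Y F` in rows of minimal ones, so only diagonal
-- extremal entries survive among pairs `a ≤ b`.
theorem commutator_eq_zero_of_ext_support (F Y : Matrix P P k)
    (hY : ∀ a b, Y a b ≠ 0 → a ∈ Ext P ∧ b ∈ Ext P ∧ a < b) (a b : P) (hab : a ≤ b)
    (h : a < b ∨ a ∉ Ext P) : (F * Y - Y * F) b a = 0 := by
  rw [commutator_apply, Finset.sum_eq_zero, Finset.sum_eq_zero, sub_zero]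
  · intro j _
    by_contra hne
    obtain ⟨h1, h2, h3⟩ := hY _ _ (left_ne_zero_of_mul hne)
    rcases hab.eq_or_lt with rfl | hlt
    · exact h.elim (fun h => h.ne rfl) fun h => h h1
    · exact (isMin_of_mem_ext h1 h3).not_lt hlt
  · intro i _
    by_contra hne
    obtain ⟨h1, h2, h3⟩ := hY _ _ (right_ne_zero_of_mul hne)
    rcases hab.eq_or_lt with rfl | hlt
    · exact h.elim (fun h => h.ne rfl) fun h => h h2
    · exact (isMax_of_mem_ext h2 h3).not_lt hlt

/-- The kernel equations at the extremal elements, restricted to matrices supported on the strict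
relations between extremal elements. -/
noncomputable def extEquations (F : Matrix P P k) : (ExtRel P → k) →ₗ[k] (Ext P → k) :=
  LinearMap.pi fun v => Matrix.entryLinearMap k k (v : P) (v : P) ∘ₗ
    (LinearMap.mulLeft k F - LinearMap.mulRight k F) ∘ₗ extMatrix

theorem extEquations_apply (F : Matrix P P k) (y : ExtRel P → k) (v : Ext P) :
    extEquations F y v = (F * extMatrix y - extMatrix y * F) v v := rfl

/-- A solution satisfies every kernel equation, and its pairing with `F` vanishes automatically. -/
theorem ContactMatrix.extEquations_injective {F : Matrix P P k} (hF : ContactMatrix F) :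
    Function.Injective (extEquations F) := by
  classical
  rw [← LinearMap.ker_eq_bot, LinearMap.ker_eq_bot']
  intro y hy
  have hsupp := extMatrix_support y
  have hupper : ∀ i j, ¬ i ≤ j → extMatrix y i j = 0 := fun i j hij => by
    by_contra h
    exact hij (hsupp i j h).2.2.le
  have hdiag : ∀ v, extMatrix y v v = 0 := fun v => by
    by_contra h
    exact (hsupp v v h).2.2.ne rfl
  have hE : ∀ v ∈ Ext P, (F * extMatrix y - extMatrix y * F) v v = 0 := fun v hv =>
    congrFun hy ⟨v, hv⟩
  have h0 : extMatrix y = 0 := by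
    refine hF _ hupper (Finset.sum_eq_zero fun v _ => hdiag v) ?_ ?_
    · intro a b hab
      by_cases h : a < b ∨ a ∉ Ext P
      · exact commutator_eq_zero_of_ext_support F _ hsupp a b hab h
      · push Not at h
        obtain rfl := hab.eq_of_not_lt h.1
        exact hE _ h.2
    · refine trace_mul_eq_zero F _ hupper hE (fun v _ => hdiag v) fun v hv => ?_
      rw [mul_apply]
      refine Finset.sum_eq_zero fun i _ => ?_
      by_contra h
      exact hv (hsupp _ _ (right_ne_zero_of_mul h)).2.1
  ext ⟨⟨a, b⟩, hab⟩
  have h1 := congrFun (congrFun h0 a) b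
  have h2 : extMatrix y a b = y ⟨(a, b), hab⟩ := dif_pos hab
  rw [← h2, h1]
  rfl

omit [DecidableEq P] in
open Classical in
theorem sum_ext_commutator (F X : Matrix P P k)
    (hX : ∀ v, v ∉ Ext P → (F * X - X * F) v v = 0) :
    ∑ v : Ext P, (F * X - X * F) v v = 0 := by
  classical
  have h0 : (F * X - X * F).trace = 0 := by rw [trace_sub, trace_mul_comm, sub_self]
  rw [trace, ← Fintype.sum_subtype_add_sum_subtype (fun v => v ∈ Ext P)] at h0
  have h1 : ∑ i : {v // v ∉ Ext P}, (F * X - X * F).diag i = 0 :=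
    Finset.sum_eq_zero fun v _ => hX v v.2
  rw [h1, add_zero] at h0
  exact h0

open Classical in
-- The injective image lies in the sum-zero hyperplane, while a connected graph has at least `|Ext
-- P| - 1` edges; dimensions force equality.
theorem ContactMatrix.range_extEquations {F : Matrix P P k} (hF : ContactMatrix F)
    (hc : (SimpleGraph.hasse (Ext P)).Connected) :
    Nat.card (ExtRel P) + 1 = Nat.card (Ext P) ∧
      ∀ f : Ext P → k, ∑ v, f v = 0 → ∃ y, extEquations F y = f := by
  classical
  let s : (Ext P → k) →ₗ[k] k := ∑ v, LinearMap.proj v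
  have hs : ∀ f, s f = ∑ v, f v := fun f => by simp [s, LinearMap.sum_apply]
  have hsurj : Function.Surjective s := by
    obtain ⟨v⟩ := hc.nonempty
    intro c
    exact ⟨Pi.single v c, by simp [hs]⟩
  have hrank := s.finrank_range_add_finrank_ker
  rw [LinearMap.range_eq_top.mpr hsurj, finrank_top, Module.finrank_self,
    Module.finrank_fintype_fun_eq_card] at hrank
  have hle : LinearMap.range (extEquations F) ≤ LinearMap.ker s := by
    rintro _ ⟨y, rfl⟩
    rw [LinearMap.mem_ker, hs]
    exact sum_ext_commutator F _ fun v hv =>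
      commutator_eq_zero_of_ext_support F _ (extMatrix_support y) v v le_rfl (Or.inr hv)
  have hcard := LinearMap.finrank_range_of_inj hF.extEquations_injective
  rw [Module.finrank_fintype_fun_eq_card] at hcard
  have h1 := Submodule.finrank_mono hle
  have h2 := hc.card_vert_le_card_edgeSet_add_one
  rw [card_edgeSet_hasse_ext] at h2
  simp only [Nat.card_eq_fintype_card] at h2 ⊢
  have heq : LinearMap.range (extEquations F) = LinearMap.ker s :=
    Submodule.eq_of_le_of_finrank_eq hle (by omega)
  refine ⟨by omega, fun f hf => ?_⟩
  have : f ∈ LinearMap.range (extEquations F) := by rw [heq, LinearMap.mem_ker, hs, hf]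
  exact this

theorem ContactMatrix.isTree {F : Matrix P P k} (hF : ContactMatrix F)
    (hc : (SimpleGraph.hasse (Ext P)).Connected) : (SimpleGraph.hasse (Ext P)).IsTree := by
  rw [SimpleGraph.isTree_iff_connected_and_card, card_edgeSet_hasse_ext]
  exact ⟨hc, (hF.range_extEquations hc).1⟩

/-- A matrix satisfying all kernel equations except those at extremal elements can be completed to
one satisfying all of them by changing entries at relations between extremal elements. -/
theorem ContactMatrix.exists_completion {F : Matrix P P k} (hF : ContactMatrix F)
    (hc : (SimpleGraph.hasse (Ext P)).Connected) (X : Matrix P P k)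
    (hX : ∀ i j, ¬ i ≤ j → X i j = 0)
    (hE : ∀ a b, a ≤ b → a < b ∨ a ∉ Ext P → (F * X - X * F) b a = 0) :
    ∃ Z : Matrix P P k, (∀ i j, ¬ i ≤ j → Z i j = 0) ∧
      (∀ a b, a ≤ b → (F * Z - Z * F) b a = 0) ∧
      ∀ a b, ¬ (a ∈ Ext P ∧ b ∈ Ext P ∧ a < b) → Z a b = X a b := by
  classical
  obtain ⟨y, hy⟩ := (hF.range_extEquations hc).2 (fun v => -(F * X - X * F) v v) (by
    rw [Finset.sum_neg_distrib,
      sum_ext_commutator F X fun v hv => hE v v le_rfl (Or.inr hv), neg_zero])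
  have hsupp := extMatrix_support y
  have hsplit : F * (X + extMatrix y) - (X + extMatrix y) * F =
      (F * X - X * F) + (F * extMatrix y - extMatrix y * F) := by
    rw [mul_add, add_mul]; abel
  refine ⟨X + extMatrix y, ?_, ?_, ?_⟩
  · intro i j hij
    have : extMatrix y i j = 0 := by
      by_contra h
      exact hij (hsupp i j h).2.2.le
    simp [hX i j hij, this]
  · intro a b hab
    rw [hsplit, Matrix.add_apply]
    by_cases h : a < b ∨ a ∉ Ext P
    · rw [hE a b hab h, commutator_eq_zero_of_ext_support F _ hsupp a b hab h, add_zero]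
    · push Not at h
      obtain rfl := hab.eq_of_not_lt h.1
      have := congrFun hy ⟨a, h.2⟩
      rw [extEquations_apply] at this
      rw [this, add_neg_cancel]
  · intro a b hab
    have : extMatrix y a b = 0 := by
      by_contra h
      exact hab (hsupp a b h)
    simp [this]

/-- Completion alters only strict extremal relations, so the completed matrix still has zero
diagonal and zero pairing, and contactness kills it. -/
theorem ContactMatrix.eq_zero_of_local {F : Matrix P P k} (hF : ContactMatrix F)
    (hc : (SimpleGraph.hasse (Ext P)).Connected) (X : Matrix P P k)
    (hX : ∀ i j, ¬ i ≤ j → X i j = 0) (hdiag : ∀ v, X v v = 0)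
    (hE : ∀ a b, a ≤ b → a < b ∨ a ∉ Ext P → (F * X - X * F) b a = 0)
    (hcol : ∀ v, v ∉ Ext P → (F * X) v v = 0)
    (a b : P) (hab : ¬ (a ∈ Ext P ∧ b ∈ Ext P ∧ a < b)) : X a b = 0 := by
  obtain ⟨Z, hZ1, hZ2, hZ3⟩ := hF.exists_completion hc X hX hE
  have hd : ∀ v, Z v v = 0 := fun v => by
    rw [hZ3 v v fun h => h.2.2.ne rfl, hdiag]
  have h0 : Z = 0 := by
    refine hF Z hZ1 (Finset.sum_eq_zero fun v _ => hd v) hZ2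
      (trace_mul_eq_zero F Z hZ1 (fun v _ => hZ2 v v le_rfl) (fun v _ => hd v) fun v hv => ?_)
    rw [← hcol v hv, mul_apply, mul_apply]
    exact Finset.sum_congr rfl fun i _ => by rw [hZ3 i v fun h => hv h.2.1]
  rw [← hZ3 a b hab, h0]
  rfl

omit [DecidableEq P] [PartialOrder P] in
theorem exists_ne_zero_of_two_equations (s : Set P) (hs : 3 ≤ s.ncard) (f g : P → k) :
    ∃ p : P → k, (∀ i, i ∉ s → p i = 0) ∧ (∃ i, p i ≠ 0) ∧ ∑ i, f i * p i = 0 ∧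
      ∑ i, g i * p i = 0 := by
  classical
  let T : (s → k) →ₗ[k] k × k :=
    LinearMap.prod (∑ i : s, f i • LinearMap.proj i) (∑ i : s, g i • LinearMap.proj i)
  have hT : LinearMap.ker T ≠ ⊥ := by
    refine LinearMap.ker_ne_bot_of_finrank_lt ?_
    rw [Module.finrank_prod, Module.finrank_self, Module.finrank_fintype_fun_eq_card,
      ← Nat.card_eq_fintype_card]
    exact hs
  obtain ⟨p, hp, hp0⟩ := Submodule.exists_mem_ne_zero_of_ne_bot hT
  have hp' : ∑ i : s, f i * p i = 0 ∧ ∑ i : s, g i * p i = 0 := by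
    simpa [T, LinearMap.sum_apply] using hp
  have hsum : ∀ h : P → k, ∑ i, h i * (if hi : i ∈ s then p ⟨i, hi⟩ else 0) =
      ∑ i : s, h i * p i := by
    intro h
    rw [← Fintype.sum_subtype_add_sum_subtype (fun i => i ∈ s)]
    rw [Finset.sum_eq_zero (s := (Finset.univ : Finset {i // i ∉ s}))
      (fun i _ => by simp [i.2]), add_zero]
    refine Fintype.sum_congr _ _ fun i => ?_
    rw [dif_pos i.2]
  refine ⟨fun i => if hi : i ∈ s then p ⟨i, hi⟩ else 0, fun i hi => dif_neg hi, ?_, ?_, ?_⟩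
  · obtain ⟨i, hi⟩ := Function.ne_iff.mp hp0
    exact ⟨i, by simpa using hi⟩
  · rw [hsum, hp'.1]
  · rw [hsum, hp'.2]

/-- For a matrix supported in column `m` on the elements below `m`, only the equations at `(m, m)`
and `(j, m)` remain: two conditions on at least three unknowns. -/
theorem ContactMatrix.ncard_lt_of_unique_above {F : Matrix P P k} (hF : ContactMatrix F)
    (hP : NoFourChain P) (hc : (SimpleGraph.hasse (Ext P)).Connected) {m j : P}
    (hm : m ∉ Ext P) (hj : ∀ b, m < b → b = j) : {a | a < m}.ncard < 3 := by
  by_contra! h3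
  obtain ⟨p, hp0, ⟨i, hi⟩, hp1, hp2⟩ := exists_ne_zero_of_two_equations {a | a < m} h3 (F j) (F m)
  have him : i < m := by
    by_contra h
    exact hi (hp0 i h)
  let X : Matrix P P k := fun a b => if b = m then p a else 0
  have hFX : ∀ a b, (F * X) b a = if a = m then ∑ i, F b i * p i else 0 := by
    intro a b
    rw [mul_apply]
    split_ifs with h <;> simp [X, h]
  have hXF : ∀ a b, (X * F) b a = p b * F m a := by
    intro a b
    rw [mul_apply]
    simp [X]
  have h0 := hF.eq_zero_of_local hc X ?_ ?_ ?_ ?_ i m fun h => hm h.2.1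
  · simp [X] at h0
    exact hi h0
  · intro a b hab
    simp only [X]
    split_ifs with h
    · exact hp0 a fun h' => hab (h ▸ le_of_lt h')
    · rfl
  · intro v
    simp only [X]
    split_ifs with h
    · exact hp0 v fun h' => lt_irrefl v (h ▸ h')
    · rfl
  · intro a b hab h
    have hpb : p b = 0 := by
      by_contra hne
      have hbm : b < m := by
        by_contra h'
        exact hne (hp0 b h')
      have hb := hP.isMin_of_lt hm hbm
      rcases hab.eq_or_lt with rfl | hlt
      · exact h.elim (fun h => h.ne rfl) fun h => h (Or.inl hb)
      · exact hb.not_lt hlt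
    rw [Matrix.sub_apply, hFX, hXF, hpb, zero_mul, sub_zero]
    split_ifs with ham
    · subst ham
      rcases hab.eq_or_lt with rfl | hlt
      · exact hp2
      · rw [hj b hlt, hp1]
    · rfl
  · intro v hv
    rw [hFX]
    split_ifs with h
    · rw [h, hp2]
    · rfl

theorem ContactMatrix.ncard_lt_of_unique_below {F : Matrix P P k} (hF : ContactMatrix F)
    (hP : NoFourChain P) (hc : (SimpleGraph.hasse (Ext P)).Connected) {m i : P}
    (hm : m ∉ Ext P) (hi : ∀ a, a < m → a = i) : {b | m < b}.ncard < 3 := by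
  by_contra! h3
  obtain ⟨q, hq0, ⟨j, hj⟩, hq1, hq2⟩ := exists_ne_zero_of_two_equations {b | m < b} h3
    (fun b => F b i) (fun b => F b m)
  have hmj : m < j := by
    by_contra h
    exact hj (hq0 j h)
  let X : Matrix P P k := fun a b => if a = m then q b else 0
  have hFX : ∀ a b, (F * X) b a = F b m * q a := by
    intro a b
    rw [mul_apply]
    simp [X]
  have hXF : ∀ a b, (X * F) b a = if b = m then ∑ j, F j a * q j else 0 := by
    intro a b
    rw [mul_apply]
    split_ifs with h <;> simp [X, h, mul_comm]
  have hqmax : ∀ a, q a ≠ 0 → IsMax a := by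
    intro a ha
    refine hP.isMax_of_gt hm ?_
    by_contra h'
    exact ha (hq0 a h')
  have h0 := hF.eq_zero_of_local hc X ?_ ?_ ?_ ?_ m j fun h => hm h.1
  · simp [X] at h0
    exact hj h0
  · intro a b hab
    simp only [X]
    split_ifs with h
    · exact hq0 b fun h' => hab (h ▸ le_of_lt h')
    · rfl
  · intro v
    simp only [X]
    split_ifs with h
    · exact hq0 v fun h' => lt_irrefl v (h ▸ h')
    · rfl
  · intro a b hab h
    have hqa : q a = 0 := by
      by_contra hne
      have ha := hqmax a hne
      rcases hab.eq_or_lt with rfl | hlt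
      · exact h.elim (fun h => h.ne rfl) fun h => h (Or.inr ha)
      · exact ha.not_lt hlt
    rw [Matrix.sub_apply, hFX, hXF, hqa, mul_zero, zero_sub, neg_eq_zero]
    split_ifs with hbm
    · subst hbm
      rcases hab.eq_or_lt with rfl | hlt
      · exact hq2
      · rw [hi a hlt, hq1]
    · rfl
  · intro v hv
    rw [hFX]
    by_contra h
    exact hv (Or.inr (hqmax v (right_ne_zero_of_mul h)))

/-- If both sides of `m` have two elements, these form a 4-cycle in the tree; otherwise the
one-sided bounds apply. -/
theorem ContactMatrix.ncard_ext_comparable {F : Matrix P P k} (hF : ContactMatrix F)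
    (hP : NoFourChain P) (hc : (SimpleGraph.hasse (Ext P)).Connected) {m : P} (hm : m ∉ Ext P) :
    (Ext (comparable m)).ncard = 2 ∨ (Ext (comparable m)).ncard = 3 := by
  rw [LiePoset.ncard_ext_comparable hP hm]
  obtain ⟨i, hi⟩ := exists_lt_of_notMem_ext hm
  obtain ⟨j, hj⟩ := exists_gt_of_notMem_ext hm
  have h1 : 0 < {a | a < m}.ncard := (Set.ncard_pos).mpr ⟨i, hi⟩
  have h2 : 0 < {b | m < b}.ncard := (Set.ncard_pos).mpr ⟨j, hj⟩
  by_cases hup : ∀ b, m < b → b = j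
  · have h3 := hF.ncard_lt_of_unique_above hP hc hm hup
    have h4 : {b | m < b}.ncard ≤ 1 := (Set.ncard_le_one_iff (Set.toFinite _)).mpr fun {a b} ha hb =>
      (hup a ha).trans (hup b hb).symm
    omega
  by_cases hdown : ∀ a, a < m → a = i
  · have h3 := hF.ncard_lt_of_unique_below hP hc hm hdown
    have h4 : {a | a < m}.ncard ≤ 1 := (Set.ncard_le_one_iff (Set.toFinite _)).mpr fun {a b} ha hb =>
      (hdown a ha).trans (hdown b hb).symm
    omega
  push Not at hup hdown
  obtain ⟨j', hj', hjj'⟩ := hup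
  obtain ⟨i', hi', hii'⟩ := hdown
  exact absurd (hF.isTree hc) (not_isTree_of_lt_lt (Or.inl (hP.isMin_of_lt hm hi'))
    (Or.inl (hP.isMin_of_lt hm hi)) (Or.inr (hP.isMax_of_gt hm hj'))
    (Or.inr (hP.isMax_of_gt hm hj)) (hi'.trans hj') (hi.trans hj') (hi'.trans hj) (hi.trans hj)
    hii' hjj')

end Necessity

/-! ### Necessity: exactly one element with two extremal neighbours -/

section UniqueTwo

variable {k P : Type*} [Field k] [Fintype P] [DecidableEq P] [PartialOrder P]

open Matrix

omit [PartialOrder P] in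
theorem mul_single_entry (F : Matrix P P k) (i j a b : P) (c : k) :
    (F * single i j c) b a = if a = j then F b i * c else 0 := by
  rw [mul_apply]
  by_cases h : a = j
  · simp [single_apply, h]
  · simp [h, Ne.symm h]

omit [PartialOrder P] in
theorem single_mul_entry (F : Matrix P P k) (i j a b : P) (c : k) :
    (single i j c * F) b a = if b = i then c * F j a else 0 := by
  rw [mul_apply]
  by_cases h : b = i
  · simp [single_apply, h]
  · simp [h, Ne.symm h]

/-- Otherwise the elementary matrix at `(i, j)` is a nonzero common kernel vector. -/
theorem ContactMatrix.apply_ne_zero {F : Matrix P P k} (hF : ContactMatrix F) {i j : P}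
    (hi : i ∈ Ext P) (hj : j ∈ Ext P) (hij : i < j) : F j i ≠ 0 := by
  intro h0
  have hsupp : ∀ a b, single i j (1 : k) a b ≠ 0 → i = a ∧ j = b := by
    intro a b h
    by_contra h'
    exact h (by simp only [single_apply]; rw [if_neg h'])
  have := hF (single i j 1) ?_ ?_ ?_ ?_
  · have h1 := congrFun (congrFun this i) j
    simp at h1
  · intro a b hab
    by_contra h
    obtain ⟨rfl, rfl⟩ := hsupp a b h
    exact hab hij.le
  · exact trace_single_eq_of_ne _ _ _ hij.ne
  · intro a b hab
    rw [Matrix.sub_apply, mul_single_entry, single_mul_entry]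
    have h1 : (if a = j then F b i * 1 else 0 : k) = 0 := by
      split_ifs with h
      · subst h
        rw [← (isMax_of_mem_ext hj hij).eq_of_le hab, h0, zero_mul]
      · rfl
    have h2 : (if b = i then 1 * F j a else 0 : k) = 0 := by
      split_ifs with h
      · subst h
        rw [(isMin_of_mem_ext hi hij).eq_of_le hab, h0, mul_zero]
      · rfl
    rw [h1, h2, sub_zero]
  · simp [trace_mul_single, h0]

/-- A non-extremal element with one element below and one above gives an element of the kernel. -/
theorem ContactMatrix.exists_kernel_element {F : Matrix P P k} (hF : ContactMatrix F)
    (hP : NoFourChain P) (hc : (SimpleGraph.hasse (Ext P)).Connected) {m : P} (hm : m ∉ Ext P)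
    (h2 : (Ext (comparable m)).ncard = 2) :
    ∃ X : Matrix P P k, (∀ i j, ¬ i ≤ j → X i j = 0) ∧ X.trace = 0 ∧
      (∀ a b, a ≤ b → (F * X - X * F) b a = 0) ∧
      ∀ v, X v v = if v = m then 1 - (Fintype.card P : k) else 1 := by
  rw [LiePoset.ncard_ext_comparable hP hm] at h2
  obtain ⟨i, him⟩ := exists_lt_of_notMem_ext hm
  obtain ⟨j, hmj⟩ := exists_gt_of_notMem_ext hm
  have hn1 : 0 < {a | a < m}.ncard := (Set.ncard_pos).mpr ⟨i, him⟩
  have hn2 : 0 < {b | m < b}.ncard := (Set.ncard_pos).mpr ⟨j, hmj⟩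
  have hi : ∀ a, a < m → a = i := fun a ha =>
    (Set.ncard_le_one_iff (Set.toFinite _)).mp (by omega : {a | a < m}.ncard ≤ 1) ha him
  have hj : ∀ b, m < b → b = j := fun b hb =>
    (Set.ncard_le_one_iff (Set.toFinite _)).mp (by omega : {b | m < b}.ncard ≤ 1) hb hmj
  have himin := hP.isMin_of_lt hm him
  have hjmax := hP.isMax_of_gt hm hmj
  have hF0 : F j i ≠ 0 := hF.apply_ne_zero (Or.inl himin) (Or.inr hjmax) (him.trans hmj)
  let N : k := Fintype.card P
  -- The diagonal `s` has trace zero. The equations at `(j, m)` and `(m, i)` determine `p` and `q`,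
  -- and the one at `(m, m)` then holds automatically.
  let s : P → k := fun v => if v = m then 1 - N else 1
  let p : k := N * F j m / F j i
  let q : k := N * F m i / F j i
  let X : Matrix P P k := diagonal s + single i m p + single m j q
  have hE : ∀ a b, (F * X - X * F) b a = (s a - s b) * F b a +
      ((if a = m then F b i * p else 0) - (if b = i then p * F m a else 0)) +
      ((if a = j then F b m * q else 0) - (if b = m then q * F j a else 0)) := by
    intro a b
    simp only [X, mul_add, add_mul, Matrix.sub_apply, Matrix.add_apply, mul_single_entry,
      single_mul_entry, mul_diagonal, diagonal_mul]
    ring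
  have hdiag : ∀ v, X v v = s v := by
    intro v
    have h1 : ¬ (i = v ∧ m = v) := by rintro ⟨rfl, h⟩; exact him.ne' h
    have h2 : ¬ (m = v ∧ j = v) := by rintro ⟨rfl, h⟩; exact hmj.ne' h
    simp [X, h1, h2]
  have hup : ∀ a b, ¬ a ≤ b → X a b = 0 := by
    intro a b hab
    have h0 : a ≠ b := fun h => hab h.le
    have h1 : ¬ (i = a ∧ m = b) := by rintro ⟨rfl, rfl⟩; exact hab him.le
    have h2 : ¬ (m = a ∧ j = b) := by rintro ⟨rfl, rfl⟩; exact hab hmj.le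
    simp [X, h0, h1, h2]
  have hloc : ∀ a b, a ≤ b → a < b ∨ a ∉ Ext P → (F * X - X * F) b a = 0 := by
    intro a b hab h
    rw [hE]
    have hbi : b ≠ i := by
      rintro rfl
      rcases hab.eq_or_lt with rfl | hlt
      · exact h.elim (fun h => h.ne rfl) fun h => h (Or.inl himin)
      · exact himin.not_lt hlt
    have haj : a ≠ j := by
      rintro rfl
      rcases hab.eq_or_lt with rfl | hlt
      · exact h.elim (fun h => h.ne rfl) fun h => h (Or.inr hjmax)
      · exact hjmax.not_lt hlt
    rw [if_neg hbi, if_neg haj]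
    by_cases ham : a = m
    · subst ham
      rcases hab.eq_or_lt with rfl | hlt
      · simp only [if_true, p, q]
        field_simp
        ring
      · rw [hj b hlt, if_pos rfl, if_neg hmj.ne']
        simp only [s, if_true, if_neg hmj.ne', p]
        field_simp
        ring
    · rw [if_neg ham]
      by_cases hbm : b = m
      · subst hbm
        rw [hi a (lt_of_le_of_ne hab ham), if_pos rfl]
        simp only [s, if_true, if_neg him.ne, q]
        field_simp
        ring
      · rw [if_neg hbm]
        simp [s, ham, hbm]
  obtain ⟨Z, hZ1, hZ2, hZ3⟩ := hF.exists_completion hc X hup hloc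
  have hZd : ∀ v, Z v v = s v := fun v => by rw [hZ3 v v fun h => h.2.2.ne rfl, hdiag]
  refine ⟨Z, hZ1, ?_, hZ2, hZd⟩
  have hs : ∀ v, s v = 1 - (if v = m then N else 0) := by
    intro v
    simp only [s]
    split_ifs <;> simp
  simp [trace, hZd, hs, N]

/-- Two such elements give radical vectors with different diagonals; the combination on which the
form vanishes must be zero, which the diagonal entries at `v` and `m` refute. -/
theorem ContactMatrix.eq_of_ncard_eq_two [CharZero k] {F : Matrix P P k} (hF : ContactMatrix F)
    (hP : NoFourChain P) (hc : (SimpleGraph.hasse (Ext P)).Connected) {m m' : P} (hm : m ∉ Ext P)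
    (hm' : m' ∉ Ext P) (h2 : (Ext (comparable m)).ncard = 2)
    (h2' : (Ext (comparable m')).ncard = 2) : m' = m := by
  by_contra hne
  obtain ⟨X, hX1, hX2, hX3, hX4⟩ := hF.exists_kernel_element hP hc hm h2
  obtain ⟨Y, hY1, hY2, hY3, hY4⟩ := hF.exists_kernel_element hP hc hm' h2'
  obtain ⟨v, hv⟩ := exists_lt_of_notMem_ext hm
  have hvm : v ≠ m := hv.ne
  have hvm' : v ≠ m' := fun h => hm' (h ▸ Or.inl (hP.isMin_of_lt hm hv))
  have hb : (F * Y).trace ≠ 0 := by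
    intro h0
    have h1 := hF Y hY1 hY2 hY3 h0
    have h3 := hY4 v
    rw [h1, if_neg hvm'] at h3
    exact zero_ne_one h3
  have hN : (Fintype.card P : k) ≠ 0 := by
    have : Nonempty P := ⟨m⟩
    exact_mod_cast Fintype.card_ne_zero
  have h0 := hF ((F * Y).trace • X - (F * X).trace • Y) ?_ ?_ ?_ ?_
  · have h1 := congrFun (congrFun h0 v) v
    have h3 := congrFun (congrFun h0 m) m
    simp only [Matrix.sub_apply, Matrix.smul_apply, hX4, hY4, if_neg hvm, if_neg hvm', if_true,
      if_neg (Ne.symm hne), smul_eq_mul, Matrix.zero_apply] at h1 h3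
    have h4 : (F * Y).trace * (Fintype.card P : k) = 0 := by linear_combination h1 - h3
    exact (mul_ne_zero hb hN) h4
  · intro a b hab
    simp [hX1 a b hab, hY1 a b hab]
  · simp [trace_sub, trace_smul, hX2, hY2]
  · intro a b hab
    have : F * ((F * Y).trace • X - (F * X).trace • Y) -
        ((F * Y).trace • X - (F * X).trace • Y) * F =
        (F * Y).trace • (F * X - X * F) - (F * X).trace • (F * Y - Y * F) := by
      simp only [mul_sub, sub_mul, mul_smul_comm, smul_mul_assoc, smul_sub]
      abel
    rw [this, Matrix.sub_apply, Matrix.smul_apply, Matrix.smul_apply, hX3 a b hab, hY3 a b hab]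
    simp
  · simp only [mul_sub, mul_smul_comm, trace_sub, trace_smul, smul_eq_mul]
    ring

/-- If every one of the `r` non-extremal elements had value three, the tree's edge count would give
the even dimension `2 |Ext P| + 4 r - 2`. -/
theorem exists_ncard_eq_two (hP : NoFourChain P)
    (htree : (SimpleGraph.hasse (Ext P)).IsTree)
    (hodd : Odd (Module.finrank k (typeALiePosetAlgebra k P)))
    (h23 : ∀ i : P, i ∉ Ext P → (Ext (comparable i)).ncard = 2 ∨ (Ext (comparable i)).ncard = 3) :
    ∃ i : P, i ∉ Ext P ∧ (Ext (comparable i)).ncard = 2 := by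
  classical
  by_contra! h
  have hn : Nonempty P := by
    obtain ⟨v⟩ := htree.connected.nonempty
    exact ⟨v⟩
  have h1 := finrank_typeALiePosetAlgebra (k := k) (P := P)
  have h2 := card_le_pairs hP
  have h3 := (SimpleGraph.isTree_iff_connected_and_card.mp htree).2
  rw [card_edgeSet_hasse_ext] at h3
  have h4 : ∑ m ∈ Finset.univ.filter (fun m : P => m ∉ Ext P), (Ext (comparable m)).ncard =
      (Finset.univ.filter (fun m : P => m ∉ Ext P)).card * 3 := by
    rw [Finset.sum_const_nat]
    intro m hm
    have hm := (Finset.mem_filter.mp hm).2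
    exact (h23 m hm).resolve_left (h m hm)
  have h5 : (Finset.univ.filter (fun m : P => m ∈ Ext P)).card +
      (Finset.univ.filter (fun m : P => m ∉ Ext P)).card = Fintype.card P :=
    Finset.card_filter_add_card_filter_not _
  have h6 : Nat.card (Ext P) = (Finset.univ.filter (fun m : P => m ∈ Ext P)).card := by
    rw [Nat.card_eq_fintype_card, Fintype.card_subtype]
  obtain ⟨r, hr⟩ := hodd
  omega

theorem conditions_of_isContact [CharZero k] (hconn : (SimpleGraph.hasse P).Connected)
    (hP : NoFourChain P) (h : IsContact k (typeALiePosetAlgebra k P)) :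
    (∀ i : P, i ∉ Ext P → (Ext (comparable i)).ncard = 2 ∨ (Ext (comparable i)).ncard = 3) ∧
      (∃! i : P, i ∉ Ext P ∧ (Ext (comparable i)).ncard = 2) ∧
      (SimpleGraph.hasse (Ext P)).IsTree := by
  have hc := hasse_ext_connected hP hconn
  obtain ⟨F, hF⟩ := exists_contactMatrix h
  have htree := hF.isTree hc
  have h23 : ∀ i : P, i ∉ Ext P →
      (Ext (comparable i)).ncard = 2 ∨ (Ext (comparable i)).ncard = 3 :=
    fun i hi => hF.ncard_ext_comparable hP hc hi
  obtain ⟨m, hm, h2⟩ := exists_ncard_eq_two hP htree h.exists_form.1 h23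
  exact ⟨h23, ⟨m, ⟨hm, h2⟩, fun m' hm' => hF.eq_of_ncard_eq_two hP hc hm hm'.1 h2 hm'.2⟩, htree⟩

end UniqueTwo

/-! ### Sufficiency: an explicit contact form -/

section Sufficiency

variable {k P : Type*} [Field k] [Fintype P] [PartialOrder P]

open Matrix

theorem sum_eq_add_add {ι : Type*} [Fintype ι] {f : ι → k} {a b c : ι}
    (hab : a ≠ b) (hac : a ≠ c) (hbc : b ≠ c) (h : ∀ x, x ≠ a → x ≠ b → x ≠ c → f x = 0) :
    ∑ x, f x = f a + f b + f c := by
  classical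
  rw [← Finset.sum_subset (Finset.subset_univ {a, b, c})]
  · rw [Finset.sum_insert (by simp [hab, hac]), Finset.sum_pair hbc, add_assoc]
  · intro x _ hx
    simp only [Finset.mem_insert, Finset.mem_singleton, not_or] at hx
    exact h x hx.1 hx.2.1 hx.2.2

section LocalSums

variable {X : Matrix P P k} (hX : ∀ i j, ¬ i ≤ j → X i j = 0) (w : P → k)
include hX

theorem column_sum_of_isMin {i : P} (hi : IsMin i) : ∑ l, w l * X l i = w i * X i i :=
  Fintype.sum_eq_single i fun l hl => by
    rw [hX _ _ fun h => hl (hi.eq_of_le h), mul_zero]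

theorem row_sum_of_isMax {j : P} (hj : IsMax j) : ∑ l, X j l * w l = X j j * w j :=
  Fintype.sum_eq_single j fun l hl => by
    rw [hX _ _ fun h => hl (hj.eq_of_le h).symm, zero_mul]

theorem column_sum_of_one_below {m i : P} (him : i < m) (hi : ∀ a, a < m → a = i) :
    ∑ l, w l * X l m = w m * X m m + w i * X i m :=
  Fintype.sum_eq_add m i him.ne' fun l hl => by
    rw [hX _ _ fun h => hl.2 (hi _ (lt_of_le_of_ne h hl.1)), mul_zero]

theorem row_sum_of_one_above {m j : P} (hmj : m < j) (hj : ∀ b, m < b → b = j) :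
    ∑ l, X m l * w l = X m m * w m + X m j * w j :=
  Fintype.sum_eq_add m j hmj.ne fun l hl => by
    rw [hX _ _ fun h => hl.2 (hj _ (lt_of_le_of_ne h hl.1.symm)), zero_mul]

theorem column_sum_of_two_below {m i i' : P} (him : i < m) (him' : i' < m) (hne : i ≠ i')
    (hi : ∀ a, a < m → a = i ∨ a = i') :
    ∑ l, w l * X l m = w m * X m m + w i * X i m + w i' * X i' m :=
  sum_eq_add_add him.ne' him'.ne' hne fun l h1 h2 h3 => by
    rw [hX _ _ fun h => (hi _ (lt_of_le_of_ne h h1)).elim h2 h3, mul_zero]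

theorem row_sum_of_two_above {m j j' : P} (hmj : m < j) (hmj' : m < j') (hne : j ≠ j')
    (hj : ∀ b, m < b → b = j ∨ b = j') :
    ∑ l, X m l * w l = X m m * w m + X m j * w j + X m j' * w j' :=
  sum_eq_add_add hmj.ne hmj'.ne hne fun l h1 h2 h3 => by
    rw [hX _ _ fun h => (hj _ (lt_of_le_of_ne h h1.symm)).elim h2 h3, zero_mul]

end LocalSums

section Local

variable {F X : Matrix P P k} (hX : ∀ i j, ¬ i ≤ j → X i j = 0)
  (hE : ∀ a b, a ≤ b → ∑ l, F b l * X l a = ∑ l, X b l * F l a)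
  (hF : ∀ a ∈ Ext P, ∀ b ∈ Ext P, a < b → F b a = 1)
include hX hE hF

theorem diag_eq_of_lt {i j : P} (hi : i ∈ Ext P) (hj : j ∈ Ext P) (hij : i < j) :
    X i i = X j j := by
  have h := hE i j hij.le
  rw [column_sum_of_isMin hX _ (isMin_of_mem_ext hi hij),
    row_sum_of_isMax hX (fun l => F l i) (isMax_of_mem_ext hj hij), hF i hi j hj hij] at h
  simpa using h

theorem diag_eq_of_mem_ext (hc : (SimpleGraph.hasse (Ext P)).Connected) {v w : P}
    (hv : v ∈ Ext P) (hw : w ∈ Ext P) : X v v = X w w := by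
  have hwalk : ∀ a b : Ext P, (SimpleGraph.hasse (Ext P)).Reachable a b →
      X (a : P) a = X (b : P) b := by
    rintro a b ⟨p⟩
    induction p with
    | nil => rfl
    | cons hadj _ ih =>
      rw [← ih]
      rcases hasse_ext_adj.mp hadj with h | h
      · exact diag_eq_of_lt hX hE hF (Subtype.property _) (Subtype.property _) h
      · exact (diag_eq_of_lt hX hE hF (Subtype.property _) (Subtype.property _) h).symm
  exact hwalk ⟨v, hv⟩ ⟨w, hw⟩ (hc.preconnected _ _)

variable (hP : NoFourChain P) {s : k} (hs : ∀ v ∈ Ext P, X v v = s) {m : P} (hm : m ∉ Ext P)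
include hP hs hm

omit hs in
theorem local_zero_of_one_one {i j : P} (him : i < m) (hi : ∀ a, a < m → a = i)
    (hmj : m < j) (hj : ∀ b, m < b → b = j) (hFi : F m i = 0) (hFj : F j m = 0) :
    X i m = 0 ∧ X m j = 0 := by
  have himin := hP.isMin_of_lt hm him
  have hjmax := hP.isMax_of_gt hm hmj
  have hFji := hF i (Or.inl himin) j (Or.inr hjmax) (him.trans hmj)
  have h1 := hE i m him.le
  have h2 := hE m j hmj.le
  rw [column_sum_of_isMin hX _ himin, row_sum_of_one_above hX (fun l => F l i) hmj hj] at h1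
  rw [column_sum_of_one_below hX _ him hi, row_sum_of_isMax hX (fun l => F l m) hjmax] at h2
  simp only [hFi, hFj, hFji, zero_mul, mul_zero, zero_add, one_mul, mul_one] at h1 h2
  exact ⟨h2, h1.symm⟩

/-- The system is triangular: `(j', m)` gives `X i m = 0`, then `(j, m)` gives `X m m = s`, `(m, m)`
gives `X m j = 0`, and `(m, i)` gives `X m j' = 0`. -/
theorem local_zero_of_one_two {i j j' : P} (him : i < m) (hi : ∀ a, a < m → a = i)
    (hmj : m < j) (hmj' : m < j') (hne : j ≠ j') (hj : ∀ b, m < b → b = j ∨ b = j')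
    (hFi : F m i = 0) (hFj : F j m = 1) (hFj' : F j' m = 0) (hFm : F m m = 0) :
    X m m = s ∧ X i m = 0 ∧ X m j = 0 ∧ X m j' = 0 := by
  have himin := hP.isMin_of_lt hm him
  have hjmax := hP.isMax_of_gt hm hmj
  have hjmax' := hP.isMax_of_gt hm hmj'
  have hFji := hF i (Or.inl himin) j (Or.inr hjmax) (him.trans hmj)
  have hFji' := hF i (Or.inl himin) j' (Or.inr hjmax') (him.trans hmj')
  have h1 := hE i m him.le
  have h2 := hE m j hmj.le
  have h3 := hE m j' hmj'.le
  have h4 := hE m m le_rfl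
  rw [column_sum_of_isMin hX _ himin,
    row_sum_of_two_above hX (fun l => F l i) hmj hmj' hne hj] at h1
  rw [column_sum_of_one_below hX _ him hi, row_sum_of_isMax hX (fun l => F l m) hjmax] at h2
  rw [column_sum_of_one_below hX _ him hi, row_sum_of_isMax hX (fun l => F l m) hjmax'] at h3
  rw [column_sum_of_one_below hX _ him hi,
    row_sum_of_two_above hX (fun l => F l m) hmj hmj' hne hj] at h4
  simp only [hFi, hFj, hFj', hFm, hFji, hFji', hs j (Or.inr hjmax), zero_mul, mul_zero, zero_add,
    one_mul, mul_one, add_zero] at h1 h2 h3 h4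
  rw [h3, add_zero] at h2
  rw [← h4, zero_add] at h1
  exact ⟨h2, h3, h4.symm, h1.symm⟩

theorem local_zero_of_two_one {i i' j : P} (him : i < m) (him' : i' < m) (hne : i ≠ i')
    (hi : ∀ a, a < m → a = i ∨ a = i') (hmj : m < j) (hj : ∀ b, m < b → b = j)
    (hFi : F m i = 1) (hFi' : F m i' = 0) (hFj : F j m = 0) (hFm : F m m = 0) :
    X m m = s ∧ X i m = 0 ∧ X i' m = 0 ∧ X m j = 0 := by
  have himin := hP.isMin_of_lt hm him
  have himin' := hP.isMin_of_lt hm him'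
  have hjmax := hP.isMax_of_gt hm hmj
  have hFji := hF i (Or.inl himin) j (Or.inr hjmax) (him.trans hmj)
  have hFji' := hF i' (Or.inl himin') j (Or.inr hjmax) (him'.trans hmj)
  have h1 := hE i m him.le
  have h2 := hE i' m him'.le
  have h3 := hE m j hmj.le
  have h4 := hE m m le_rfl
  rw [column_sum_of_isMin hX _ himin, row_sum_of_one_above hX (fun l => F l i) hmj hj] at h1
  rw [column_sum_of_isMin hX _ himin', row_sum_of_one_above hX (fun l => F l i') hmj hj] at h2
  rw [column_sum_of_two_below hX _ him him' hne hi,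
    row_sum_of_isMax hX (fun l => F l m) hjmax] at h3
  rw [column_sum_of_two_below hX _ him him' hne hi,
    row_sum_of_one_above hX (fun l => F l m) hmj hj] at h4
  simp only [hFi, hFi', hFj, hFm, hFji, hFji', hs i (Or.inl himin), zero_mul, mul_zero, zero_add,
    one_mul, mul_one, add_zero] at h1 h2 h3 h4
  rw [← h2, add_zero] at h1
  rw [h4, zero_add] at h3
  exact ⟨h1.symm, h4, h3, h2.symm⟩

end Local

/-- Such an `X` is a circulation on a tree. Each edge is a bridge, and pairing the conservation law
with the indicator `f` of one side isolates the entry on that edge. -/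
theorem eq_zero_of_isTree (htree : (SimpleGraph.hasse (Ext P)).IsTree) (X : Matrix P P k)
    (hX : ∀ a b, X a b ≠ 0 → a ∈ Ext P ∧ b ∈ Ext P ∧ a < b)
    (hE : ∀ v, ∑ i, X i v = ∑ j, X v j) : X = 0 := by
  classical
  ext a b
  rw [Matrix.zero_apply]
  by_contra hne
  obtain ⟨ha, hb, hab⟩ := hX a b hne
  let G := SimpleGraph.hasse (Ext P)
  let a' : Ext P := ⟨a, ha⟩
  let b' : Ext P := ⟨b, hb⟩
  have hbridge : ¬ (G.deleteEdges {s(a', b')}).Reachable a' b' :=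
    SimpleGraph.isBridge_iff.mp (SimpleGraph.isAcyclic_iff_forall_adj_isBridge.mp htree.isAcyclic
      (hasse_ext_adj.mpr (Or.inl hab)))
  let f : P → k := fun v =>
    if ∃ h : v ∈ Ext P, (G.deleteEdges {s(a', b')}).Reachable a' ⟨v, h⟩ then 1 else 0
  have hfa : f a = 1 := if_pos ⟨ha, SimpleGraph.Reachable.refl _⟩
  have hfb : f b = 0 := if_neg fun ⟨_, h⟩ => hbridge h
  have hzero : ∑ i, ∑ v, (f v - f i) * X i v = 0 := by
    have h1 : ∑ i, ∑ v, f v * X i v = ∑ v, f v * ∑ i, X i v := by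
      rw [Finset.sum_comm]
      simp only [Finset.mul_sum]
    have h2 : ∑ i, ∑ v, f i * X i v = ∑ v, f v * ∑ j, X v j := by
      simp only [Finset.mul_sum]
    simp only [sub_mul, Finset.sum_sub_distrib, h1, h2, hE, sub_self]
  have hterm : ∀ i v, ¬ (i = a ∧ v = b) → (f v - f i) * X i v = 0 := by
    intro i v hiv
    by_cases h0 : X i v = 0
    · rw [h0, mul_zero]
    obtain ⟨hi, hv, hlt⟩ := hX i v h0
    have hadj : (G.deleteEdges {s(a', b')}).Adj ⟨i, hi⟩ ⟨v, hv⟩ := by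
      rw [SimpleGraph.deleteEdges_adj]
      refine ⟨hasse_ext_adj.mpr (Or.inl hlt), fun h => ?_⟩
      rcases Sym2.eq_iff.mp (Set.mem_singleton_iff.mp h) with ⟨h1, h2⟩ | ⟨h1, h2⟩
      · exact hiv ⟨congrArg Subtype.val h1, congrArg Subtype.val h2⟩
      · obtain rfl : i = b := congrArg Subtype.val h1
        obtain rfl : v = a := congrArg Subtype.val h2
        exact lt_asymm hlt hab
    have hf : f v = f i := by
      simp only [f]
      refine if_congr ⟨fun ⟨_, h⟩ => ⟨hi, h.trans hadj.reachable.symm⟩,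
        fun ⟨_, h⟩ => ⟨hv, h.trans hadj.reachable⟩⟩ rfl rfl
    rw [hf, sub_self, zero_mul]
  rw [Fintype.sum_eq_single a fun i hi => Finset.sum_eq_zero fun v _ => hterm i v fun h => hi h.1,
    Fintype.sum_eq_single b fun v hv => hterm a v fun h => hv h.2, hfa, hfb] at hzero
  simp at hzero
  exact hne hzero

/-- An element `κ` on the side of `m` that has two elements, for `m` having three extremal
elements comparable to it. -/
def IsChoice (m κ : P) : Prop :=
  (∃ i j, i < m ∧ (∀ a, a < m → a = i) ∧ m < κ ∧ m < j ∧ κ ≠ j ∧ ∀ b, m < b → b = κ ∨ b = j) ∨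
    ∃ i j, κ < m ∧ i < m ∧ κ ≠ i ∧ (∀ a, a < m → a = κ ∨ a = i) ∧ m < j ∧ ∀ b, m < b → b = j

theorem exists_isChoice (hP : NoFourChain P) {m : P} (hm : m ∉ Ext P)
    (h3 : (Ext (comparable m)).ncard = 3) : ∃ κ, IsChoice m κ := by
  rw [ncard_ext_comparable hP hm] at h3
  obtain ⟨i, hi⟩ := exists_lt_of_notMem_ext hm
  obtain ⟨j, hj⟩ := exists_gt_of_notMem_ext hm
  have h1 : 0 < {a | a < m}.ncard := (Set.ncard_pos).mpr ⟨i, hi⟩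
  have h2 : 0 < {b | m < b}.ncard := (Set.ncard_pos).mpr ⟨j, hj⟩
  rcases (by omega : {a | a < m}.ncard = 1 ∧ {b | m < b}.ncard = 2 ∨
    {a | a < m}.ncard = 2 ∧ {b | m < b}.ncard = 1) with ⟨ha, hb⟩ | ⟨ha, hb⟩
  · obtain ⟨i, hi⟩ := Set.ncard_eq_one.mp ha
    obtain ⟨κ, j, hne, hj⟩ := Set.ncard_eq_two.mp hb
    simp only [Set.ext_iff, Set.mem_ofPred_eq, Set.mem_singleton_iff, Set.mem_insert_iff] at hi hj
    exact ⟨κ, Or.inl ⟨i, j, (hi i).mpr rfl, fun a => (hi a).mp, (hj κ).mpr (Or.inl rfl),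
      (hj j).mpr (Or.inr rfl), hne, fun b => (hj b).mp⟩⟩
  · obtain ⟨κ, i, hne, hi⟩ := Set.ncard_eq_two.mp ha
    obtain ⟨j, hj⟩ := Set.ncard_eq_one.mp hb
    simp only [Set.ext_iff, Set.mem_ofPred_eq, Set.mem_singleton_iff, Set.mem_insert_iff] at hi hj
    exact ⟨κ, Or.inr ⟨i, j, (hi κ).mpr (Or.inl rfl), (hi i).mpr (Or.inr rfl), hne,
      fun a => (hi a).mp, (hj j).mpr rfl, fun b => (hj b).mp⟩⟩

open Classical in
/-- The matrix of a contact form: the sum of the coordinates at the relations between extremal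
elements, at one chosen relation of each non-extremal element other than `m₀`, and at the diagonal
entry of `m₀`. -/
noncomputable def contactFormMatrix (k : Type*) [Field k] (m₀ : P) (κ : P → P) : Matrix P P k :=
  Matrix.of fun b a =>
    if (a ∈ Ext P ∧ b ∈ Ext P ∧ a < b) ∨ (a ∉ Ext P ∧ a ≠ m₀ ∧ a < b ∧ b = κ a) ∨
      (b ∉ Ext P ∧ b ≠ m₀ ∧ a < b ∧ a = κ b) ∨ (a = m₀ ∧ b = m₀) then 1 else 0

section ContactFormMatrix

variable {m₀ : P} {κ : P → P}

omit [Fintype P]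

theorem contactFormMatrix_ext (a : P) (ha : a ∈ Ext P) (b : P) (hb : b ∈ Ext P) (hab : a < b) :
    contactFormMatrix k m₀ κ b a = 1 :=
  if_pos (Or.inl ⟨ha, hb, hab⟩)

theorem contactFormMatrix_self : contactFormMatrix k m₀ κ m₀ m₀ = 1 :=
  if_pos (Or.inr (Or.inr (Or.inr ⟨rfl, rfl⟩)))

theorem contactFormMatrix_diag {v : P} (hv : v ≠ m₀) : contactFormMatrix k m₀ κ v v = 0 :=
  if_neg (by simp [hv])

theorem contactFormMatrix_choice_above {m : P} (hm : m ∉ Ext P) (hne : m ≠ m₀) (h : m < κ m) :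
    contactFormMatrix k m₀ κ (κ m) m = 1 :=
  if_pos (Or.inr (Or.inl ⟨hm, hne, h, rfl⟩))

theorem contactFormMatrix_choice_below {m : P} (hm : m ∉ Ext P) (hne : m ≠ m₀) (h : κ m < m) :
    contactFormMatrix k m₀ κ m (κ m) = 1 :=
  if_pos (Or.inr (Or.inr (Or.inl ⟨hm, hne, h, rfl⟩)))

theorem contactFormMatrix_above (hP : NoFourChain P) {m b : P} (hm : m ∉ Ext P) (hmb : m < b)
    (hb : m = m₀ ∨ b ≠ κ m) : contactFormMatrix k m₀ κ b m = 0 := by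
  have hb' : b ∈ Ext P := Or.inr (hP.isMax_of_gt hm hmb)
  refine if_neg ?_
  rintro (h | h | h | h)
  · exact hm h.1
  · exact hb.elim h.2.1 fun h' => h' h.2.2.2
  · exact h.1 hb'
  · exact hmb.ne (h.1.trans h.2.symm)

theorem contactFormMatrix_below (hP : NoFourChain P) {m a : P} (hm : m ∉ Ext P) (ham : a < m)
    (ha : m = m₀ ∨ a ≠ κ m) : contactFormMatrix k m₀ κ m a = 0 := by
  have ha' : a ∈ Ext P := Or.inl (hP.isMin_of_lt hm ham)
  refine if_neg ?_
  rintro (h | h | h | h)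
  · exact hm h.2.1
  · exact h.1 ha'
  · exact ha.elim h.2.1 fun h' => h' h.2.2.2
  · exact ham.ne (h.1.trans h.2.symm)

end ContactFormMatrix

variable [DecidableEq P] {m₀ : P} {κ : P → P}

omit [DecidableEq P] in
-- At `m₀` no strict relation carries weight, so the entries there vanish but the diagonal one stays
-- free; elsewhere the chosen relation also ties the diagonal to `s`.
theorem contactFormMatrix_local (hP : NoFourChain P) (hm₀ : m₀ ∉ Ext P)
    (h2 : (Ext (comparable m₀)).ncard = 2) (hκ : ∀ m, m ∉ Ext P → m ≠ m₀ → IsChoice m (κ m))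
    {X : Matrix P P k} (hX : ∀ i j, ¬ i ≤ j → X i j = 0)
    (hE : ∀ a b, a ≤ b → ∑ l, contactFormMatrix k m₀ κ b l * X l a =
      ∑ l, X b l * contactFormMatrix k m₀ κ l a) {s : k} (hs : ∀ v ∈ Ext P, X v v = s)
    {m : P} (hm : m ∉ Ext P) :
    (m ≠ m₀ → X m m = s) ∧ (∀ a, a < m → X a m = 0) ∧ ∀ b, m < b → X m b = 0 := by
  rcases eq_or_ne m m₀ with rfl | hne
  · rw [ncard_ext_comparable hP hm] at h2
    obtain ⟨i, him⟩ := exists_lt_of_notMem_ext hm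
    obtain ⟨j, hmj⟩ := exists_gt_of_notMem_ext hm
    have hn1 : 0 < {a | a < m}.ncard := (Set.ncard_pos).mpr ⟨i, him⟩
    have hn2 : 0 < {b | m < b}.ncard := (Set.ncard_pos).mpr ⟨j, hmj⟩
    have hi : ∀ a, a < m → a = i := fun a ha =>
      (Set.ncard_le_one_iff (Set.toFinite _)).mp (by omega : {a | a < m}.ncard ≤ 1) ha him
    have hj : ∀ b, m < b → b = j := fun b hb =>
      (Set.ncard_le_one_iff (Set.toFinite _)).mp (by omega : {b | m < b}.ncard ≤ 1) hb hmj
    obtain ⟨h1, h3⟩ := local_zero_of_one_one hX hE contactFormMatrix_ext hP hm him hi hmj hj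
      (contactFormMatrix_below hP hm him (Or.inl rfl))
      (contactFormMatrix_above hP hm hmj (Or.inl rfl))
    exact ⟨fun h => absurd rfl h, fun a ha => hi a ha ▸ h1, fun b hb => hj b hb ▸ h3⟩
  · rcases hκ m hm hne with ⟨i, j, him, hi, hmκ, hmj, hκj, hj⟩ | ⟨i, j, hκm, him, hκi, hi, hmj, hj⟩
    · obtain ⟨h1, h3, h4, h5⟩ := local_zero_of_one_two hX hE contactFormMatrix_ext hP hs hm him hi
        hmκ hmj hκj hj
        (contactFormMatrix_below hP hm him (Or.inr (him.trans hmκ).ne))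
        (contactFormMatrix_choice_above hm hne hmκ)
        (contactFormMatrix_above hP hm hmj (Or.inr hκj.symm)) (contactFormMatrix_diag hne)
      refine ⟨fun _ => h1, fun a ha => hi a ha ▸ h3, fun b hb => ?_⟩
      rcases hj b hb with rfl | rfl <;> assumption
    · obtain ⟨h1, h3, h4, h5⟩ := local_zero_of_two_one hX hE contactFormMatrix_ext hP hs hm hκm him
        hκi hi hmj hj (contactFormMatrix_choice_below hm hne hκm)
        (contactFormMatrix_below hP hm him (Or.inr hκi.symm))
        (contactFormMatrix_above hP hm hmj (Or.inr (hκm.trans hmj).ne'))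
        (contactFormMatrix_diag hne)
      refine ⟨fun _ => h1, fun a ha => ?_, fun b hb => hj b hb ▸ h5⟩
      rcases hi a ha with rfl | rfl <;> assumption

omit [PartialOrder P] [DecidableEq P] in
theorem card_sub_one_ne_zero [CharZero k] {a b : P} (hab : a ≠ b) :
    (1 - (Fintype.card P : k)) ≠ 0 := by
  have h1 : 1 < Fintype.card P := Fintype.one_lt_card_iff.mpr ⟨a, b, hab⟩
  rw [sub_ne_zero]
  exact_mod_cast h1.ne

theorem contactMatrix_contactFormMatrix [CharZero k] (hP : NoFourChain P)
    (htree : (SimpleGraph.hasse (Ext P)).IsTree) (hm₀ : m₀ ∉ Ext P)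
    (h2 : (Ext (comparable m₀)).ncard = 2) (hκ : ∀ m, m ∉ Ext P → m ≠ m₀ → IsChoice m (κ m)) :
    ContactMatrix (contactFormMatrix k m₀ κ) := by
  intro X hX htr hE hFX
  have hE' : ∀ a b, a ≤ b → ∑ l, contactFormMatrix k m₀ κ b l * X l a =
      ∑ l, X b l * contactFormMatrix k m₀ κ l a := fun a b hab => by
    rw [← sub_eq_zero, ← commutator_apply, hE a b hab]
  obtain ⟨a₀, ha₀⟩ := exists_lt_of_notMem_ext hm₀
  have ha₀' : a₀ ∈ Ext P := Or.inl (hP.isMin_of_lt hm₀ ha₀)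
  have hs : ∀ v ∈ Ext P, X v v = X a₀ a₀ := fun v hv =>
    diag_eq_of_mem_ext hX hE' contactFormMatrix_ext htree.connected hv ha₀'
  have hloc := fun {m : P} (hm : m ∉ Ext P) => contactFormMatrix_local hP hm₀ h2 hκ hX hE' hs hm
  -- All other diagonal entries of `F X` vanish, so the form takes the value `X m₀ m₀` on `X`.
  have hm₀0 : X m₀ m₀ = 0 := by
    rw [trace, Fintype.sum_eq_single m₀ fun v hv => ?_, diag_apply, mul_apply,
      Fintype.sum_eq_single m₀ fun l hl => ?_, contactFormMatrix_self, one_mul] at hFX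
    · exact hFX
    · by_cases hlt : l < m₀
      · rw [(hloc hm₀).2.1 l hlt, mul_zero]
      · rw [hX l m₀ fun h => hlt (lt_of_le_of_ne h hl), mul_zero]
    · rw [diag_apply]
      by_cases hve : v ∈ Ext P
      · exact mul_apply_self_eq_zero _ X hX hve (hE v v le_rfl)
          (by rw [contactFormMatrix_diag hv, zero_mul])
      · rw [mul_apply]
        refine Finset.sum_eq_zero fun l _ => ?_
        rcases eq_or_ne l v with rfl | hl
        · rw [contactFormMatrix_diag hv, zero_mul]
        by_cases hlt : l < v
        · rw [(hloc hve).2.1 l hlt, mul_zero]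
        · rw [hX l v fun h => hlt (lt_of_le_of_ne h hl), mul_zero]
  have hdiag : ∀ v, X v v = X a₀ a₀ - if v = m₀ then X a₀ a₀ else 0 := by
    intro v
    rcases eq_or_ne v m₀ with rfl | hv
    · rw [hm₀0, if_pos rfl, sub_self]
    · rw [if_neg hv, sub_zero]
      by_cases hve : v ∈ Ext P
      · exact hs v hve
      · exact (hloc hve).1 hv
  -- The diagonal is constant except for a zero at `m₀`, so the trace is `|P| - 1` times that
  -- constant.
  have hs0 : X a₀ a₀ = 0 := by
    have h1 : X.trace = Fintype.card P * X a₀ a₀ - X a₀ a₀ := by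
      have h3 : X.trace = ∑ v, (X a₀ a₀ - if v = m₀ then X a₀ a₀ else 0) :=
        Finset.sum_congr rfl fun v _ => hdiag v
      rw [h3, Finset.sum_sub_distrib]
      simp
    rw [htr] at h1
    have h3 : (1 - (Fintype.card P : k)) * X a₀ a₀ = 0 := by linear_combination h1
    exact (mul_eq_zero.mp h3).resolve_left (card_sub_one_ne_zero ha₀.ne)
  have hdiag0 : ∀ v, X v v = 0 := fun v => by rw [hdiag, hs0]; simp
  have hsupp : ∀ a b, X a b ≠ 0 → a ∈ Ext P ∧ b ∈ Ext P ∧ a < b := by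
    intro a b hab
    have hlt : a < b := by
      refine lt_of_le_of_ne (by_contra fun h => hab (hX a b h)) ?_
      rintro rfl
      exact hab (hdiag0 a)
    exact ⟨by_contra fun h => hab ((hloc h).2.2 b hlt), by_contra fun h => hab ((hloc h).2.1 a hlt),
      hlt⟩
  refine eq_zero_of_isTree htree X hsupp fun v => ?_
  have hv := hE' v v le_rfl
  rw [Finset.sum_congr rfl fun i _ => show contactFormMatrix k m₀ κ v i * X i v = X i v from ?_,
    Finset.sum_congr rfl fun j _ => show X v j * contactFormMatrix k m₀ κ j v = X v j from ?_] at hv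
  · exact hv
  · by_cases h : X v j = 0
    · rw [h, zero_mul]
    · obtain ⟨h1, h3, h4⟩ := hsupp v j h
      rw [contactFormMatrix_ext v h1 j h3 h4, mul_one]
  · by_cases h : X i v = 0
    · rw [h, mul_zero]
    · obtain ⟨h1, h3, h4⟩ := hsupp i v h
      rw [contactFormMatrix_ext i h1 v h3 h4, one_mul]

theorem isContact_of_conditions [CharZero k] (hP : NoFourChain P)
    (h23 : ∀ i : P, i ∉ Ext P → (Ext (comparable i)).ncard = 2 ∨ (Ext (comparable i)).ncard = 3)
    (huniq : ∃! i : P, i ∉ Ext P ∧ (Ext (comparable i)).ncard = 2)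
    (htree : (SimpleGraph.hasse (Ext P)).IsTree) : IsContact k (typeALiePosetAlgebra k P) := by
  obtain ⟨m₀, ⟨hm₀, h2⟩, huniq⟩ := huniq
  have hex : ∀ m : P, ∃ κ, m ∉ Ext P → m ≠ m₀ → IsChoice m κ := by
    intro m
    by_cases h : m ∉ Ext P ∧ m ≠ m₀
    · obtain ⟨κ, hκ⟩ := exists_isChoice hP h.1
        ((h23 m h.1).resolve_left fun h' => h.2 (huniq m ⟨h.1, h'⟩))
      exact ⟨κ, fun _ _ => hκ⟩
    · exact ⟨m, fun h1 h3 => absurd ⟨h1, h3⟩ h⟩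
  choose κ hκ using hex
  obtain ⟨a₀, ha₀⟩ := exists_lt_of_notMem_ext hm₀
  -- This radical vector has trace zero and satisfies the kernel equations because `F` has no weight
  -- on strict relations at `m₀`; the form takes the value `1 - |P| ≠ 0` on it.
  let d : P → k := fun v => if v = m₀ then 1 - (Fintype.card P : k) else 1
  refine (contactMatrix_contactFormMatrix (k := k) hP htree hm₀ h2 hκ).isContact (diagonal d)
    (fun i j hij => diagonal_apply_ne _ fun h => hij h.le) ?_ ?_ ?_
  · have hd : ∀ v, d v = 1 - (if v = m₀ then (Fintype.card P : k) else 0) := by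
      intro v
      simp only [d]
      split_ifs <;> simp
    simp [trace_diagonal, hd]
  · intro a b hab
    rw [Matrix.sub_apply, mul_diagonal, diagonal_mul]
    rcases hab.eq_or_lt with rfl | hlt
    · ring
    rcases eq_or_ne a m₀ with rfl | ha
    · rw [contactFormMatrix_above hP hm₀ hlt (Or.inl rfl)]
      ring
    rcases eq_or_ne b m₀ with rfl | hb
    · rw [contactFormMatrix_below hP hm₀ hlt (Or.inl rfl)]
      ring
    simp [d, ha, hb]
  · rw [trace, Fintype.sum_eq_single m₀ fun v hv => ?_, diag_apply, mul_diagonal,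
      contactFormMatrix_self]
    · simpa [d] using card_sub_one_ne_zero (k := k) ha₀.ne
    · rw [diag_apply, mul_diagonal, contactFormMatrix_diag hv, zero_mul]

end Sufficiency

end LiePoset

theorem mainTheorem2 {k : Type*} [Field k] [IsAlgClosed k] [CharZero k]
    {P : Type*} [Fintype P] [DecidableEq P] [PartialOrder P]
    (hconn : (SimpleGraph.hasse P).Connected) (hheight : Order.krullDim P = 2) :
    LiePoset.IsContact k (LiePoset.typeALiePosetAlgebra k P) ↔
      (∀ i : P, i ∉ LiePoset.Ext P →
        (LiePoset.Ext (LiePoset.comparable i)).ncard = 2 ∨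
          (LiePoset.Ext (LiePoset.comparable i)).ncard = 3) ∧
      (∃! i : P, i ∉ LiePoset.Ext P ∧
        (LiePoset.Ext (LiePoset.comparable i)).ncard = 2) ∧
      (SimpleGraph.hasse (LiePoset.Ext P)).IsTree := by
  have hP := LiePoset.noFourChain_of_krullDim hheight
  exact ⟨LiePoset.conditions_of_isContact hconn hP,
    fun ⟨h23, huniq, htree⟩ => LiePoset.isContact_of_conditions hP h23 huniq htree⟩
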